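/- Let $p>2$ be real and let $0<k<1$. Put $k'=\sqrt{1-k^2}$ and $$F(\varphi,k)=\int_0^{\varphi}\frac{ds}{\sqrt{1-k^2\sin^2 s}},\qquad K(k)=F(\tfrac{\pi}{2},k),\qquad \Pi(\nu,n,k)=\int_0^{\nu}\frac{ds}{(1-n\sin^2 s)\sqrt{1-k^2\sin^2 s}},$$ and $\Pi(n,k)=\Pi(\tfrac{\pi}{2},n,k)$. Let $\mathrm{am}(\cdot,k)$ be the inverse function of $F(\cdot,k)$ and $\mathrm{sn}=\sin\mathrm{am}$, $\mathrm{cn}=\cos\mathrm{am}$, $\mathrm{dn}=\sqrt{1-k^2\,\mathrm{sn}^2}$ the Jacobi elliptic functions of modulus $k$. Set $$x=\frac{2K(k)}{p},\qquad \hat x=\frac{(p+2)K(k)}{p},\qquad n=k^2\,\mathrm{sn}^2\!\left(\tfrac{\hat x}{2},k\right),$$ $$\nu_\infty=\arcsin\,\mathrm{sn}\!\left(\tfrac{\hat x}{2},k\right),\qquad \nu_0=\arcsin\frac{\mathrm{cn}(\hat x/2,k)}{\mathrm{dn}(\hat x/2,k)},$$ $t_c=p\log\left(\sec^2\frac{\pi}{p}\right)$,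 let $q=\exp\left(-\pi K(k')/K(k)\right)$ be the nome, and let $\vartheta_2(z|q)=2\sum_{m\ge 0}q^{(m+1/2)^2}\cos((2m+1)z)$. Then $0<q<1$, $\vartheta_2(\pi/p\,|q)>0$, $\vartheta_2(0|q)>0$, the series in (2) converges absolutely, and for every real $t$ the following three equations are equivalent: (1) (the second two-cut endpoint equation) $$\frac t4=\frac p4\log\frac{\mathrm{dn}(x,k)}{\mathrm{cn}^2(x,k)}+\frac p2\,\frac{k'\,\mathrm{cn}(x,k)}{1+\mathrm{sn}(x,k)}\left[\Pi(\nu_\infty,n,k)-\Pi(\nu_0,n,k)-\frac2p\,\Pi(n,k)\right];$$ (2) $$\frac t4=\frac{t_c}{4}-2p\sum_{m=1}^\infty\frac{(-1)^m}{m}\,\frac{q^{2m}}{1-q^{2m}}\,\sin^2\!\left(\frac{\pi m}{p}\right);$$ (3) $$\frac t4=-\frac p2\,\log\frac{\vartheta_2(\pi/p\,|q)}{\vartheta_2(0|q)}.$$ -/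

import Mathlib

namespace TwoCut

noncomputable section

/-- Incomplete elliptic integral of the first kind `F(φ, k)` with modulus `k`. -/
def ellF (φ k : ℝ) : ℝ :=
  ∫ s in (0 : ℝ)..φ, 1 / Real.sqrt (1 - k ^ 2 * Real.sin s ^ 2)

/-- Complete elliptic integral of the first kind `K(k) = F(π/2, k)`. -/
def ellK (k : ℝ) : ℝ := ellF (Real.pi / 2) k

/-- Incomplete elliptic integral of the third kind `Π(ν, n, k)`. -/
def ellPi (ν n k : ℝ) : ℝ :=
  ∫ s in (0 : ℝ)..ν,
    1 / ((1 - n * Real.sin s ^ 2) * Real.sqrt (1 - k ^ 2 * Real.sin s ^ 2))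

/-- Complementary modulus `k' = √(1 - k²)`. -/
def compMod (k : ℝ) : ℝ := Real.sqrt (1 - k ^ 2)

/-- Jacobi amplitude: the inverse of `φ ↦ F(φ, k)`, which is a bijection of `ℝ` onto itself
for `0 ≤ k < 1` (see `ellF_bijective`). -/
def jacobiAm (u k : ℝ) : ℝ := Function.invFun (fun φ => ellF φ k) u

/-- Jacobi elliptic function `sn(u, k)`. -/
def sn (u k : ℝ) : ℝ := Real.sin (jacobiAm u k)

/-- Jacobi elliptic function `cn(u, k)`. -/
def cn (u k : ℝ) : ℝ := Real.cos (jacobiAm u k)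

/-- Jacobi elliptic function `dn(u, k)`. -/
def dn (u k : ℝ) : ℝ := Real.sqrt (1 - k ^ 2 * sn u k ^ 2)

/-- The nome `q = exp(-π K(k') / K(k))`. -/
def nome (k : ℝ) : ℝ := Real.exp (-Real.pi * ellK (compMod k) / ellK k)

/-- Jacobi's second theta function on the real axis,
`ϑ₂(z | q) = 2 ∑_{m ≥ 0} q^{(m + 1/2)²} cos((2m + 1) z)`. -/
def theta2 (z q : ℝ) : ℝ :=
  2 * ∑' m : ℕ, q ^ (((m : ℝ) + 1 / 2) ^ 2) * Real.cos ((2 * (m : ℝ) + 1) * z)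

/-- The critical coupling `t_c = p log(sec²(π/p))`. -/
def tCrit (p : ℝ) : ℝ := p * Real.log ((1 / Real.cos (Real.pi / p)) ^ 2)

/-- `x = 2 K(k) / p`. -/
def argX (p k : ℝ) : ℝ := 2 * ellK k / p

/-- `x̂ = (p + 2) K(k) / p`. -/
def argXhat (p k : ℝ) : ℝ := (p + 2) * ellK k / p

/-- The characteristic `n = k² sn²(x̂/2, k)`. -/
def charN (p k : ℝ) : ℝ := k ^ 2 * sn (argXhat p k / 2) k ^ 2

/-- The amplitude `ν_∞ ∈ [0, π/2]` with `sin ν_∞ = sn(x̂/2, k)`. -/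
def nuInf (p k : ℝ) : ℝ := Real.arcsin (sn (argXhat p k / 2) k)

/-- The amplitude `ν_0 ∈ [0, π/2]` with `sin ν_0 = cn(x̂/2, k) / dn(x̂/2, k)`. -/
def nuZero (p k : ℝ) : ℝ :=
  Real.arcsin (cn (argXhat p k / 2) k / dn (argXhat p k / 2) k)

/-- The second two-cut endpoint equation, as an equation relating `t`, `p` and the modulus `k`. -/
def EndpointEq (t p k : ℝ) : Prop :=
  t / 4 =
    p / 4 * Real.log (dn (argX p k) k / cn (argX p k) k ^ 2) +
      p / 2 * (compMod k * cn (argX p k) k / (1 + sn (argX p k) k)) *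
        (ellPi (nuInf p k) (charN p k) k - ellPi (nuZero p k) (charN p k) k
          - 2 / p * ellPi (Real.pi / 2) (charN p k) k)

/-- The summand `((-1)^n / n) (q^{2n} / (1 - q^{2n})) sin²(π n / p)` of the `q`-series. -/
def qTerm (p q : ℝ) (n : ℕ) : ℝ :=
  (-1) ^ n / (n : ℝ) * (q ^ (2 * n) / (1 - q ^ (2 * n))) * Real.sin (Real.pi * (n : ℝ) / p) ^ 2

lemma ellF_integrand_continuous {k : ℝ} (h0 : 0 ≤ k) (h1 : k < 1) :
    Continuous (fun s : ℝ => 1 / Real.sqrt (1 - k ^ 2 * Real.sin s ^ 2)) := by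
  refine continuous_const.div (by fun_prop) fun s => ?_
  have hs := Real.sin_sq_le_one s
  have : k ^ 2 < 1 := by nlinarith
  exact (Real.sqrt_pos.2 (by nlinarith [sq_nonneg (Real.sin s), sq_nonneg k])).ne'

lemma one_le_ellF_integrand {k : ℝ} (h0 : 0 ≤ k) (h1 : k < 1) (s : ℝ) :
    1 ≤ 1 / Real.sqrt (1 - k ^ 2 * Real.sin s ^ 2) := by
  have hs := Real.sin_sq_le_one s
  have hk : k ^ 2 < 1 := by nlinarith
  have hpos : 0 < 1 - k ^ 2 * Real.sin s ^ 2 := by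
    nlinarith [sq_nonneg (Real.sin s), sq_nonneg k]
  rw [le_div_iff₀ (Real.sqrt_pos.2 hpos), one_mul]
  exact Real.sqrt_le_one.2 (by nlinarith [mul_nonneg (sq_nonneg k) (sq_nonneg (Real.sin s))])

lemma sub_le_ellF_sub {k : ℝ} (h0 : 0 ≤ k) (h1 : k < 1) {a b : ℝ} (hab : a ≤ b) :
    b - a ≤ ellF b k - ellF a k := by
  have hc := ellF_integrand_continuous h0 h1
  unfold ellF
  rw [intervalIntegral.integral_interval_sub_left (hc.intervalIntegrable _ _)
    (hc.intervalIntegrable _ _)]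
  calc b - a = ∫ _ in a..b, (1 : ℝ) := by simp
    _ ≤ _ := intervalIntegral.integral_mono_on hab (by simp) (hc.intervalIntegrable _ _)
      fun s _ => one_le_ellF_integrand h0 h1 s

lemma ellF_bijective {k : ℝ} (h0 : 0 ≤ k) (h1 : k < 1) :
    Function.Bijective (fun φ => ellF φ k) := by
  have hz : ellF 0 k = 0 := by simp [ellF]
  refine ⟨StrictMono.injective fun a b hab => ?_, Continuous.surjective ?_ ?_ ?_⟩
  · have := sub_le_ellF_sub h0 h1 hab.le
    show ellF a k < ellF b k
    linarith
  · exact intervalIntegral.continuous_primitive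
      (fun a b => (ellF_integrand_continuous h0 h1).intervalIntegrable a b) 0
  · refine Filter.tendsto_atTop_mono' _ ?_ Filter.tendsto_id
    filter_upwards [Filter.eventually_ge_atTop 0] with a ha
    have := sub_le_ellF_sub h0 h1 ha
    simp only [id]
    linarith
  · refine Filter.tendsto_atBot_mono' _ ?_ Filter.tendsto_id
    filter_upwards [Filter.eventually_le_atBot 0] with a ha
    have := sub_le_ellF_sub h0 h1 ha
    simp only [id]
    linarith

/-- `am(·, k)` is the two-sided inverse of `F(·, k)`. -/
lemma ellF_jacobiAm {k : ℝ} (h0 : 0 ≤ k) (h1 : k < 1) (u : ℝ) : ellF (jacobiAm u k) k = u :=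
  Function.rightInverse_invFun (ellF_bijective h0 h1).2 u

lemma jacobiAm_ellF {k : ℝ} (h0 : 0 ≤ k) (h1 : k < 1) (φ : ℝ) : jacobiAm (ellF φ k) k = φ :=
  Function.leftInverse_invFun (ellF_bijective h0 h1).1 φ

end

end TwoCut

namespace TwoCut

noncomputable section

/-! Both equivalences are identities between right-hand sides; `t` is a spectator. Every modulus in
`(0, 1)` is `k = ϑ₂(0)² / ϑ₃(0)²` at some nome `exp (-π s)` (`exists_ek_eq`), and then `s = K(k') /
K(k)`, so this is the nome of the statement (`nome_ek`). With theta variable `v = z / π` and `u = 2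
K v`, the functions `sn`, `cn`, `dn` become theta quotients. The argument `x` becomes `v = 1 / p`,
and `x̂ / 2` becomes `a = 1 / 4 + 1 / (2 p)`.

(1) ⇔ (3): up to the factor `sn a / (2 cn a dn a)`, an integral of the third kind with parameter `a`
is a linear function of `v` minus `log (ϑ₄(v + a) / ϑ₄(v - a))` (`ellPi_eam`). The three integrals
sit at `v = a`, `1 / 2 - a`, `1 / 2`, and since `2 a - 1 / 2 = 1 / p` the linear parts cancel in the
bracket. The prefactor `k' cn x / (1 + sn x)` is `cn a dn a / sn a` (`half_argument_formula`), which
removes the algebraic factor. The logarithms of `ϑ₃` and `ϑ₄` left over cancel those in `log (dn /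
cn²)`, and only `ϑ₂` survives (`endpoint_rhs`).

(2) ⇔ (3): the triple product gives `ϑ₂(z) / ϑ₂(0)` as `cos z` times an infinite product. Expanding
the logarithms and summing the double series the other way yields the `q`-series, while `cos (π /
p)` yields `t_c` (`theta2_eq_exp`, `log_theta2_ratio`).

All theta relations used come from one product formula, `jacobiTheta₂_mul_jacobiTheta₂`. The value
of `ϑ₁'(0)` is never computed: only its behaviour under `s ↦ 1 / s` matters. -/

lemma tsum_int_prod_parity {f : ℤ × ℤ → ℂ} (hf : Summable f) :
    ∑' p, f p = ∑' p : ℤ × ℤ, f (p.1 + p.2, p.1 - p.2)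
      + ∑' p : ℤ × ℤ, f (p.1 + p.2 + 1, p.1 - p.2) := by
  -- The two summands parametrize the pairs with even and with odd coordinate sum.
  let g : (ℤ × ℤ) ⊕ (ℤ × ℤ) → ℤ × ℤ :=
    Sum.elim (fun p => (p.1 + p.2, p.1 - p.2)) (fun p => (p.1 + p.2 + 1, p.1 - p.2))
  have hg : Function.Bijective g := by
    constructor
    · rintro (⟨a, b⟩ | ⟨a, b⟩) (⟨c, d⟩ | ⟨c, d⟩) h <;>
        simp only [g, Sum.elim_inl, Sum.elim_inr, Prod.mk.injEq] at h <;>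
        simp only [Sum.inl.injEq, Sum.inr.injEq, Prod.mk.injEq, reduceCtorEq] <;> omega
    · rintro ⟨m, n⟩
      rcases Int.even_or_odd' (m + n) with ⟨c, hc | hc⟩
      · exact ⟨Sum.inl (c, m - c), by simp only [g, Sum.elim_inl, Prod.mk.injEq]; omega⟩
      · exact ⟨Sum.inr (c, m - c - 1), by simp only [g, Sum.elim_inr, Prod.mk.injEq]; omega⟩
  let e := Equiv.ofBijective g hg
  have hs : Summable (f ∘ e) := e.summable_iff.2 hf
  rw [← e.tsum_eq f]
  exact Summable.tsum_sum (f := f ∘ e) (hs.comp_injective Sum.inl_injective)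
    (hs.comp_injective Sum.inr_injective)

/-! ### Complex theta functions and their product formulas -/

section ComplexTheta

open Complex

/-- Since `(a + b)² + (a - b)² = 2 a² + 2 b²`, passing to sum and difference of the indices
decouples the double series again, at `2 τ`. The odd class shifts both arguments by `τ`, half the
new quasi-period. -/
lemma jacobiTheta₂_mul_jacobiTheta₂ (x y : ℂ) {τ : ℂ} (hτ : 0 < τ.im) :
    jacobiTheta₂ x τ * jacobiTheta₂ y τ =
      jacobiTheta₂ (x + y) (2 * τ) * jacobiTheta₂ (x - y) (2 * τ) +
        cexp (2 * Real.pi * I * x + Real.pi * I * τ) *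
          (jacobiTheta₂ (x + y + τ) (2 * τ) * jacobiTheta₂ (x - y + τ) (2 * τ)) := by
  have h2τ : 0 < (2 * τ).im := by simpa using hτ
  have hn : ∀ (z σ : ℂ), 0 < σ.im → Summable fun n => ‖jacobiTheta₂_term n z σ‖ :=
    fun z σ h => ((summable_jacobiTheta₂_term_iff z σ).2 h).norm
  unfold jacobiTheta₂
  rw [tsum_mul_tsum_of_summable_norm (hn _ _ hτ) (hn _ _ hτ),
    tsum_mul_tsum_of_summable_norm (hn _ _ h2τ) (hn _ _ h2τ),
    tsum_mul_tsum_of_summable_norm (hn _ _ h2τ) (hn _ _ h2τ),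
    tsum_int_prod_parity (summable_mul_of_summable_norm (hn _ _ hτ) (hn _ _ hτ)), ← tsum_mul_left]
  congr 1 <;> refine tsum_congr fun p => ?_ <;>
    simp only [jacobiTheta₂_term, ← Complex.exp_add] <;> congr 1 <;> push_cast <;> ring

/-- `ϑ₃` with nome `exp (-π s)`, as a function of `z / π`. -/
def cth3 (s : ℝ) (v : ℂ) : ℂ := jacobiTheta₂ v (I * s)

/-- `ϑ₂` with nome `exp (-π s)`, as a function of `z / π`. -/
def cth2 (s : ℝ) (v : ℂ) : ℂ :=
  cexp (-Real.pi * s / 4 + Real.pi * I * v) * jacobiTheta₂ (v + I * s / 2) (I * s)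

variable {s : ℝ}

lemma im_I_mul_pos (hs : 0 < s) : 0 < (I * s).im := by simpa using hs

lemma cth3_mul_cth3 (hs : 0 < s) (x y : ℂ) :
    cth3 s x * cth3 s y = cth3 (2 * s) (x + y) * cth3 (2 * s) (x - y)
      + cth2 (2 * s) (x + y) * cth2 (2 * s) (x - y) := by
  have h := jacobiTheta₂_mul_jacobiTheta₂ x y (im_I_mul_pos hs)
  have e : (I * ((2 * s : ℝ) : ℂ)) = 2 * (I * s) := by push_cast; ring
  have e' : 2 * (I * (s : ℂ)) / 2 = I * s := by ring
  simp only [cth3, cth2, e, e', h]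
  congr 1
  have : ∀ a b A B : ℂ, cexp a * A * (cexp b * B) = cexp (a + b) * (A * B) := by
    intro a b A B
    rw [Complex.exp_add]; ring
  rw [this]
  congr 2
  push_cast
  linear_combination (Real.pi * s : ℂ) * I_sq

/-- With both arguments moved by `I s / 2`, the difference is unchanged and the sum moves by half a
quasi-period at `2 s`. In the odd class the sum moves by a full one, which is why `ϑ₂` and `ϑ₃` mix.
-/
lemma cth2_mul_cth2 (hs : 0 < s) (x y : ℂ) :
    cth2 s x * cth2 s y = cth2 (2 * s) (x + y) * cth3 (2 * s) (x - y)
      + cth3 (2 * s) (x + y) * cth2 (2 * s) (x - y) := by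
  have h := jacobiTheta₂_mul_jacobiTheta₂ (x + I * s / 2) (y + I * s / 2) (im_I_mul_pos hs)
  have e : (I * ((2 * s : ℝ) : ℂ)) = 2 * (I * s) := by push_cast; ring
  have e' : 2 * (I * (s : ℂ)) / 2 = I * s := by ring
  have e1 : x + I * s / 2 + (y + I * s / 2) = x + y + I * s := by ring
  have e2 : x + I * s / 2 - (y + I * s / 2) = x - y := by ring
  have e3 : x + y + I * s + I * s = x + y + 2 * (I * s) := by ring
  simp only [e1, e2, e3, jacobiTheta₂_add_left'] at h
  simp only [cth3, cth2, e, e']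
  rw [mul_mul_mul_comm, ← Complex.exp_add, h, mul_add]
  congr 1
  · rw [← mul_assoc, ← mul_assoc]
    congr 3
    push_cast
    ring
  · have : ∀ a b c A B : ℂ, cexp a * (cexp b * (cexp c * A * B)) = cexp (a + b + c) * (A * B) := by
      intro a b c A B
      rw [Complex.exp_add, Complex.exp_add]; ring
    rw [this, mul_left_comm]
    congr 3
    push_cast
    ring

lemma cth3_neg (v : ℂ) : cth3 s (-v) = cth3 s v := jacobiTheta₂_neg_left _ _

lemma cth3_add_one (v : ℂ) : cth3 s (v + 1) = cth3 s v := jacobiTheta₂_add_left _ _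

lemma cth2_add_one (v : ℂ) : cth2 s (v + 1) = -cth2 s v := by
  unfold cth2
  rw [show v + 1 + I * s / 2 = v + I * s / 2 + 1 by ring, jacobiTheta₂_add_left,
    show -Real.pi * s / 4 + Real.pi * I * (v + 1)
      = (-Real.pi * s / 4 + Real.pi * I * v) + Real.pi * I by ring, Complex.exp_add _ (_ * I),
    Complex.exp_pi_mul_I]
  ring

lemma cth2_neg (v : ℂ) : cth2 s (-v) = cth2 s v := by
  unfold cth2
  rw [← jacobiTheta₂_neg_left (-v + _), show v + I * s / 2 = -(-v + I * s / 2) + I * s by ring,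
    jacobiTheta₂_add_left', ← mul_assoc, ← Complex.exp_add]
  congr 2
  ring

lemma cth3_conj (v : ℝ) : (starRingEnd ℂ) (cth3 s v) = cth3 s v := by
  unfold cth3
  rw [jacobiTheta₂_conj]
  simp

lemma cth2_conj (v : ℝ) : (starRingEnd ℂ) (cth2 s v) = cth2 s v := by
  rw [← cth2_neg (v : ℂ)]
  nth_rw 1 [cth2_neg]
  unfold cth2
  rw [map_mul, jacobiTheta₂_conj, ← Complex.exp_conj, ← jacobiTheta₂_neg_left]
  simp only [map_add, map_mul, map_div₀, map_neg, conj_ofReal, conj_I, map_ofNat]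
  congr 2 <;> ring

/-- Real-valued `ϑ₃`. -/
def th3 (s v : ℝ) : ℝ := (cth3 s v).re

/-- Real-valued `ϑ₂`. -/
def th2 (s v : ℝ) : ℝ := (cth2 s v).re

lemma ofReal_th3 (v : ℝ) : (th3 s v : ℂ) = cth3 s v := conj_eq_iff_re.1 (cth3_conj v)

lemma ofReal_th2 (v : ℝ) : (th2 s v : ℂ) = cth2 s v := conj_eq_iff_re.1 (cth2_conj v)

lemma hasDerivAt_cth3 (hs : 0 < s) (v : ℂ) :
    HasDerivAt (cth3 s) (jacobiTheta₂' v (I * s)) v :=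
  hasDerivAt_jacobiTheta₂_fst v (im_I_mul_pos hs)

lemma hasDerivAt_cth2 (hs : 0 < s) (v : ℂ) :
    HasDerivAt (cth2 s) (cexp (-Real.pi * s / 4 + Real.pi * I * v) *
      (Real.pi * I * jacobiTheta₂ (v + I * s / 2) (I * s)
        + jacobiTheta₂' (v + I * s / 2) (I * s))) v := by
  have h1 := (hasDerivAt_jacobiTheta₂_fst (v + I * s / 2) (im_I_mul_pos hs)).comp_add_const v
    (I * s / 2)
  have h2 : HasDerivAt (fun v : ℂ => cexp (-Real.pi * s / 4 + Real.pi * I * v))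
      (cexp (-Real.pi * s / 4 + Real.pi * I * v) * (Real.pi * I * 1)) v :=
    (((hasDerivAt_id v).const_mul (Real.pi * I : ℂ)).const_add _).cexp
  exact (h2.mul h1).congr_deriv (by ring)

lemma differentiable_th3 (hs : 0 < s) : Differentiable ℝ (th3 s) := fun v =>
  ((hasDerivAt_cth3 hs v).real_of_complex).differentiableAt

lemma hasDerivAt_th2 (hs : 0 < s) (v : ℝ) : HasDerivAt (th2 s)
    (cexp (-Real.pi * s / 4 + Real.pi * I * v) *
      (Real.pi * I * jacobiTheta₂ (v + I * s / 2) (I * s)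
        + jacobiTheta₂' (v + I * s / 2) (I * s))).re v :=
  (hasDerivAt_cth2 hs v).real_of_complex

lemma differentiable_th2 (hs : 0 < s) : Differentiable ℝ (th2 s) := fun v =>
  (hasDerivAt_th2 hs v).differentiableAt

end ComplexTheta

/-! ### Real theta functions: addition formulas and the Wronskian -/

section RealTheta

/-- Real-valued `ϑ₄`. -/
def th4 (s v : ℝ) : ℝ := th3 s (v + 1 / 2)

/-- Real-valued `ϑ₁`. -/
def th1 (s v : ℝ) : ℝ := th2 s (v - 1 / 2)

variable {s : ℝ}

lemma th3_mul_th3 (hs : 0 < s) (x y : ℝ) :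
    th3 s x * th3 s y = th3 (2 * s) (x + y) * th3 (2 * s) (x - y)
      + th2 (2 * s) (x + y) * th2 (2 * s) (x - y) := by
  have h := cth3_mul_cth3 hs x y
  rw [← Complex.ofReal_add, ← Complex.ofReal_sub] at h
  simp only [← ofReal_th3, ← ofReal_th2] at h
  exact_mod_cast h

lemma th2_mul_th2 (hs : 0 < s) (x y : ℝ) :
    th2 s x * th2 s y = th2 (2 * s) (x + y) * th3 (2 * s) (x - y)
      + th3 (2 * s) (x + y) * th2 (2 * s) (x - y) := by
  have h := cth2_mul_cth2 hs x y
  rw [← Complex.ofReal_add, ← Complex.ofReal_sub] at h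
  simp only [← ofReal_th3, ← ofReal_th2] at h
  exact_mod_cast h

lemma th3_neg (v : ℝ) : th3 s (-v) = th3 s v := by simp [th3, cth3_neg]

lemma th2_neg (v : ℝ) : th2 s (-v) = th2 s v := by simp [th2, cth2_neg]

lemma th3_add_one (v : ℝ) : th3 s (v + 1) = th3 s v := by simp [th3, cth3_add_one]

lemma th2_add_one (v : ℝ) : th2 s (v + 1) = -th2 s v := by simp [th2, cth2_add_one]

lemma th4_sub_half (v : ℝ) : th4 s (v - 1 / 2) = th3 s v := by simp [th4]

lemma th4_add_half (v : ℝ) : th4 s (v + 1 / 2) = th3 s v := by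
  rw [th4, add_assoc, show (1 / 2 + 1 / 2 : ℝ) = 1 by norm_num, th3_add_one]

lemma th3_sub_half (v : ℝ) : th3 s (v - 1 / 2) = th4 s v := by
  rw [← th4_add_half, sub_add_cancel]

lemma th1_add_half (v : ℝ) : th1 s (v + 1 / 2) = th2 s v := by simp [th1]

lemma th2_add_half (v : ℝ) : th2 s (v + 1 / 2) = -th1 s v := by
  rw [th1, show v + 1 / 2 = v - 1 / 2 + 1 by ring, th2_add_one]

lemma th1_sub_half (v : ℝ) : th1 s (v - 1 / 2) = -th2 s v := by
  have h := th2_add_half (s := s) (v - 1 / 2)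
  rw [sub_add_cancel] at h
  rw [h, neg_neg]

lemma th4_neg (v : ℝ) : th4 s (-v) = th4 s v := by
  rw [th4, ← th3_neg, show -(-v + 1 / 2) = v - 1 / 2 by ring, th3_sub_half]

lemma th1_neg (v : ℝ) : th1 s (-v) = -th1 s v := by
  rw [th1, ← th2_neg, show -(-v - 1 / 2) = v + 1 / 2 by ring, th2_add_half]

lemma th1_zero : th1 s 0 = 0 := by
  have := th1_neg (s := s) 0
  rw [neg_zero] at this
  linarith

lemma th4_mul_th4 (hs : 0 < s) (x y : ℝ) :
    th4 s x * th4 s y = th3 (2 * s) (x + y) * th3 (2 * s) (x - y)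
      - th2 (2 * s) (x + y) * th2 (2 * s) (x - y) := by
  rw [th4, th4, th3_mul_th3 hs, show x + 1 / 2 + (y + 1 / 2) = x + y + 1 by ring,
    show x + 1 / 2 - (y + 1 / 2) = x - y by ring, th3_add_one, th2_add_one]
  ring

lemma th1_mul_th1 (hs : 0 < s) (x y : ℝ) :
    th1 s x * th1 s y = th3 (2 * s) (x + y) * th2 (2 * s) (x - y)
      - th2 (2 * s) (x + y) * th3 (2 * s) (x - y) := by
  have h2 := th2_add_one (s := 2 * s) (x + y - 1)
  have h3 := th3_add_one (s := 2 * s) (x + y - 1)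
  rw [sub_add_cancel] at h2 h3
  rw [th1, th1, th2_mul_th2 hs, show x - 1 / 2 + (y - 1 / 2) = x + y - 1 by ring,
    show x - 1 / 2 - (y - 1 / 2) = x - y by ring, h2, h3]
  ring

lemma th1_mul_th2 (hs : 0 < s) (x y : ℝ) :
    th1 s x * th2 s y = th1 (2 * s) (x + y) * th4 (2 * s) (x - y)
      + th4 (2 * s) (x + y) * th1 (2 * s) (x - y) := by
  rw [th1, th2_mul_th2 hs, show x - 1 / 2 + y = x + y - 1 / 2 by ring,
    show x - 1 / 2 - y = x - y - 1 / 2 by ring, th3_sub_half, th3_sub_half, ← th1, ← th1]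

lemma th3_mul_th4 (hs : 0 < s) (x y : ℝ) :
    th3 s x * th4 s y = th4 (2 * s) (x + y) * th4 (2 * s) (x - y)
      - th1 (2 * s) (x + y) * th1 (2 * s) (x - y) := by
  rw [th4, th3_mul_th3 hs, show x + (y + 1 / 2) = x + y + 1 / 2 by ring,
    show x - (y + 1 / 2) = x - y - 1 / 2 by ring, th3_sub_half, ← th4, ← th1, th2_add_half]
  ring

/-- Addition formula of mixed type. -/
lemma th1_add_mul_th4_sub (hs : 0 < s) (x y : ℝ) :
    th1 s (x + y) * th4 s (x - y) * (th2 s 0 * th3 s 0) =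
      th1 s x * th4 s x * (th2 s y * th3 s y) + th2 s x * th3 s x * (th1 s y * th4 s y) := by
  -- Every product is expanded in `th1` and `th4` at `2 s` with arguments `x + y` and `x - y`; the
  -- claim becomes a polynomial identity.
  have a1 := th1_mul_th2 hs (x + y) 0
  have a2 := th3_mul_th4 hs 0 (x - y)
  have a3 := th1_mul_th2 hs x y
  have a4 := th3_mul_th4 hs y x
  have a5 := th1_mul_th2 hs y x
  have a6 := th3_mul_th4 hs x y
  simp only [add_zero, sub_zero, zero_add, zero_sub] at a1 a2
  rw [th4_neg, th1_neg] at a2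
  rw [add_comm y x, ← neg_sub x y, th4_neg, th1_neg] at a4 a5
  calc th1 s (x + y) * th4 s (x - y) * (th2 s 0 * th3 s 0)
      = (th1 s (x + y) * th2 s 0) * (th3 s 0 * th4 s (x - y)) := by ring
    _ = (th1 s x * th2 s y) * (th3 s y * th4 s x) + (th1 s y * th2 s x) * (th3 s x * th4 s y) := by
        rw [a1, a2, a3, a4, a5, a6]; ring
    _ = _ := by ring

/-- At `2 s` both sides are polynomials in `th2` and `th3` at `2 x`, `2 y` and `0`. -/
lemma th4_add_mul_th4_sub (hs : 0 < s) (x y : ℝ) :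
    th4 s (x + y) * th4 s (x - y) * th4 s 0 ^ 2 =
      th4 s x ^ 2 * th4 s y ^ 2 - th1 s x ^ 2 * th1 s y ^ 2 := by
  have a1 := th4_mul_th4 hs (x + y) (x - y)
  have a2 := th4_mul_th4 hs 0 0
  have a3 := th4_mul_th4 hs x x
  have a4 := th4_mul_th4 hs y y
  have a5 := th1_mul_th1 hs x x
  have a6 := th1_mul_th1 hs y y
  rw [show x + y + (x - y) = x + x by ring, show x + y - (x - y) = y + y by ring] at a1
  simp only [sub_self, add_zero] at a2 a3 a4 a5 a6
  simp only [sq, a1, a2, a3, a4, a5, a6]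
  ring

/-- This is `sn² + cn² = 1` in theta form; `th3_sq_mul` is likewise `dn² = 1 - k² sn²`. -/
lemma th2_sq_mul (hs : 0 < s) (v : ℝ) :
    th2 s v ^ 2 * th4 s 0 ^ 2 = th2 s 0 ^ 2 * th4 s v ^ 2 - th3 s 0 ^ 2 * th1 s v ^ 2 := by
  have a1 := th2_mul_th2 hs v v
  have a2 := th4_mul_th4 hs 0 0
  have a3 := th4_mul_th4 hs v v
  have a4 := th2_mul_th2 hs 0 0
  have a5 := th1_mul_th1 hs v v
  have a6 := th3_mul_th3 hs 0 0
  simp only [sub_self, add_zero] at a1 a2 a3 a4 a5 a6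
  simp only [sq, a1, a2, a3, a4, a5, a6]
  ring

lemma th3_sq_mul (hs : 0 < s) (v : ℝ) :
    th3 s v ^ 2 * th4 s 0 ^ 2 = th3 s 0 ^ 2 * th4 s v ^ 2 - th2 s 0 ^ 2 * th1 s v ^ 2 := by
  have a1 := th2_mul_th2 hs 0 0
  have a2 := th4_mul_th4 hs 0 0
  have a3 := th4_mul_th4 hs v v
  have a4 := th3_mul_th3 hs v v
  have a5 := th1_mul_th1 hs v v
  have a6 := th3_mul_th3 hs 0 0
  simp only [sub_self, add_zero] at a1 a2 a3 a4 a5 a6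
  simp only [sq, a1, a2, a3, a4, a5, a6]
  ring

lemma th4_half : th4 s (1 / 2) = th3 s 0 := by simpa using th4_add_half (s := s) 0

lemma th3_half : th3 s (1 / 2) = th4 s 0 := by simp [th4]

lemma th1_half : th1 s (1 / 2) = th2 s 0 := by simp [th1]

/-- Jacobi's quartic identity. -/
lemma th3_zero_pow_four (hs : 0 < s) : th3 s 0 ^ 4 = th2 s 0 ^ 4 + th4 s 0 ^ 4 := by
  have h := th3_sq_mul hs (1 / 2)
  rw [th3_half, th4_half, th1_half] at h
  linear_combination -h

lemma differentiable_th4 (hs : 0 < s) : Differentiable ℝ (th4 s) :=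
  (differentiable_th3 hs).comp (differentiable_id.add_const _)

lemma differentiable_th1 (hs : 0 < s) : Differentiable ℝ (th1 s) :=
  (differentiable_th2 hs).comp (differentiable_id.sub_const _)

/-- Derivative of `ϑ₁` at the origin. -/
def th1D (s : ℝ) : ℝ := deriv (th1 s) 0

/-- Differentiate `th1_add_mul_th4_sub` in `y` at `0`: `th2` and `th3` are even and `th1` vanishes
there, so one term remains. In quotient form this is `sn' = cn dn`. -/
lemma th1_th4_wronskian (hs : 0 < s) (x : ℝ) :
    (deriv (th1 s) x * th4 s x - th1 s x * deriv (th4 s) x) * (th2 s 0 * th3 s 0) =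
      th2 s x * th3 s x * (th1D s * th4 s 0) := by
  have d1 : HasDerivAt (th1 s) (deriv (th1 s) x) (x + 0) := by
    rw [add_zero]; exact (differentiable_th1 hs x).hasDerivAt
  have d4 : HasDerivAt (th4 s) (deriv (th4 s) x) (x - 0) := by
    rw [sub_zero]; exact (differentiable_th4 hs x).hasDerivAt
  have e1 := (differentiable_th1 hs 0).hasDerivAt
  have e4 := (differentiable_th4 hs 0).hasDerivAt
  have e2 := (differentiable_th2 hs 0).hasDerivAt
  have e3 := (differentiable_th3 hs 0).hasDerivAt
  have z2 : deriv (th2 s) 0 = 0 := by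
    have h : HasDerivAt (fun v => th2 s (-v)) (-deriv (th2 s) 0) 0 := by
      have e2' : HasDerivAt (th2 s) (deriv (th2 s) 0) (-0) := by rwa [neg_zero]
      exact (e2'.scomp (0 : ℝ) (hasDerivAt_neg (0 : ℝ))).congr_deriv (by simp)
    simp only [th2_neg] at h
    have := h.unique e2
    linarith
  have z3 : deriv (th3 s) 0 = 0 := by
    have h : HasDerivAt (fun v => th3 s (-v)) (-deriv (th3 s) 0) 0 := by
      have e3' : HasDerivAt (th3 s) (deriv (th3 s) 0) (-0) := by rwa [neg_zero]
      exact (e3'.scomp (0 : ℝ) (hasDerivAt_neg (0 : ℝ))).congr_deriv (by simp)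
    simp only [th3_neg] at h
    have := h.unique e3
    linarith
  have hL := ((d1.comp_const_add x 0).mul (d4.comp_const_sub x 0)).mul_const (th2 s 0 * th3 s 0)
  have hR := ((e2.mul e3).const_mul (th1 s x * th4 s x)).add
    ((e1.mul e4).const_mul (th2 s x * th3 s x))
  have := hL.unique (hR.congr_of_eventuallyEq
    (Filter.Eventually.of_forall fun y => th1_add_mul_th4_sub hs x y))
  simp only [th1_zero, z2, z3, add_zero, sub_zero] at this
  rw [th1D]
  linear_combination this

end RealTheta

/-! ### The transformation `s ↦ 1 / s` and positivity -/

section Modular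

open Complex

variable {s : ℝ}

lemma th3_zero_eq (s : ℝ) : (th3 s 0 : ℂ) = jacobiTheta₂ 0 (I * s) := by
  rw [ofReal_th3]; simp [cth3]

lemma th4_zero_eq (s : ℝ) : (th4 s 0 : ℂ) = jacobiTheta₂ (1 / 2) (I * s) := by
  rw [th4, ofReal_th3]; simp [cth3]

lemma th2_zero_eq (s : ℝ) :
    (th2 s 0 : ℂ) = cexp (-Real.pi * s / 4) * jacobiTheta₂ (I * s / 2) (I * s) := by
  rw [ofReal_th2]; simp [cth2]

lemma neg_I_mul_I_mul_cpow (hs : 0 < s) : (-I * (I * s)) ^ (1 / 2 : ℂ) = ((√s : ℝ) : ℂ) := by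
  rw [show -I * (I * s) = (s : ℂ) by linear_combination (-s : ℂ) * I_sq, Real.sqrt_eq_rpow,
    ofReal_cpow hs.le]
  norm_num

lemma neg_one_div_I_mul (hs : 0 < s) : -1 / (I * (s : ℂ)) = I * ((1 / s : ℝ) : ℂ) := by
  have : (s : ℂ) ≠ 0 := by exact_mod_cast hs.ne'
  push_cast
  field_simp
  linear_combination -I_sq

lemma jacobiTheta₂_modular (hs : 0 < s) (z : ℂ) : jacobiTheta₂ z (I * s) =
    1 / ((√s : ℝ) : ℂ) * cexp (-Real.pi * I * z ^ 2 / (I * s)) *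
      jacobiTheta₂ (z / (I * s)) (I * ((1 / s : ℝ) : ℂ)) := by
  rw [jacobiTheta₂_functional_equation, neg_I_mul_I_mul_cpow hs, neg_one_div_I_mul hs]

lemma th3_zero_modular (hs : 0 < s) : th3 (1 / s) 0 = √s * th3 s 0 := by
  have h := jacobiTheta₂_modular hs 0
  have h0 : ((√s : ℝ) : ℂ) ≠ 0 := by exact_mod_cast (Real.sqrt_pos.2 hs).ne'
  simp only [zero_div, ← th3_zero_eq, ne_eq, OfNat.ofNat_ne_zero, not_false_eq_true, zero_pow,
    mul_zero, Complex.exp_zero] at h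
  have : (th3 (1 / s) 0 : ℂ) = ((√s : ℝ) : ℂ) * th3 s 0 := by rw [h]; field_simp
  exact_mod_cast this

lemma th2_zero_modular (hs : 0 < s) : th2 (1 / s) 0 = √s * th4 s 0 := by
  have h := jacobiTheta₂_modular hs (1 / 2)
  have h0 : ((√s : ℝ) : ℂ) ≠ 0 := by exact_mod_cast (Real.sqrt_pos.2 hs).ne'
  have h1 : (s : ℂ) ≠ 0 := by exact_mod_cast hs.ne'
  have e1 : (1 / 2 : ℂ) / (I * s) = -(I * ((1 / s : ℝ) : ℂ) / 2) := by
    push_cast; field_simp; linear_combination I_sq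
  have e2 : -Real.pi * I * (1 / 2) ^ 2 / (I * s) = -Real.pi * ((1 / s : ℝ) : ℂ) / 4 := by
    push_cast; field_simp; norm_num
  rw [← th4_zero_eq, e1, e2, jacobiTheta₂_neg_left, mul_assoc, ← th2_zero_eq] at h
  have : (th2 (1 / s) 0 : ℂ) = ((√s : ℝ) : ℂ) * th4 s 0 := by rw [h]; field_simp
  exact_mod_cast this

lemma th4_zero_modular (hs : 0 < s) : th4 (1 / s) 0 = √s * th2 s 0 := by
  have h := th2_zero_modular (one_div_pos.2 hs)
  rw [one_div_one_div] at h
  rw [h, ← mul_assoc, ← Real.sqrt_mul hs.le, mul_one_div_cancel hs.ne', Real.sqrt_one, one_mul]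

/-- At this zero the terms without a derivative drop out of the functional equation for
`jacobiTheta₂'`. -/
lemma jacobiTheta₂_th1_zero (s : ℝ) :
    jacobiTheta₂ (-1 / 2 + I * s / 2) (I * s) = 0 := by
  have h : (th1 s 0 : ℂ) = 0 := by exact_mod_cast th1_zero
  rw [th1, ofReal_th2, cth2, mul_eq_zero] at h
  have := h.resolve_left (Complex.exp_ne_zero _)
  rw [← this]
  congr 1
  push_cast
  ring

lemma th1D_eq (hs : 0 < s) : (th1D s : ℂ) =
    -I * cexp (-Real.pi * s / 4) * jacobiTheta₂' (-1 / 2 + I * s / 2) (I * s) := by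
  have hd := (hasDerivAt_cth2 hs ((0 - 1 / 2 : ℝ) : ℂ))
  have hreal : HasDerivAt (fun v : ℝ => (th2 s v : ℂ)) ((deriv (th2 s) (0 - 1 / 2) : ℝ) : ℂ)
      (0 - 1 / 2) := (differentiable_th2 hs _).hasDerivAt.ofReal_comp
  have hc := hd.comp_ofReal
  simp only [← ofReal_th2] at hc
  have key := hreal.unique hc
  have hD : th1D s = deriv (th2 s) (0 - 1 / 2) := by
    unfold th1D th1
    exact deriv_comp_sub_const ..
  rw [hD, key, show (((0 - 1 / 2 : ℝ) : ℂ)) + I * s / 2 = -1 / 2 + I * s / 2 by push_cast; ring,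
    jacobiTheta₂_th1_zero s, mul_zero, zero_add]
  congr 1
  rw [Complex.exp_add, mul_comm]
  congr 1
  rw [show Real.pi * I * ((0 - 1 / 2 : ℝ) : ℂ) = -(Real.pi / 2 * I) by push_cast; ring,
    Complex.exp_neg, Complex.exp_pi_div_two_mul_I, Complex.inv_I]

/-- The inversion carries the zero of `jacobiTheta₂_th1_zero` at `s` to the one at `1 / s`, up to a
period. The extra factor `s`, compared with the theta constants, comes from the chain rule. -/
lemma th1D_modular (hs : 0 < s) : th1D (1 / s) = s * √s * th1D s := by
  have h0 : ((√s : ℝ) : ℂ) ≠ 0 := by exact_mod_cast (Real.sqrt_pos.2 hs).ne'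
  have h1 : (s : ℂ) ≠ 0 := by exact_mod_cast hs.ne'
  have hz : (-1 / 2 + I * s / 2) / (I * s) = (-1 / 2 + I * ((1 / s : ℝ) : ℂ) / 2) + 1 := by
    push_cast; field_simp; linear_combination (-1 : ℂ) * I_sq
  have he : cexp (-Real.pi * I * (-1 / 2 + I * s / 2) ^ 2 / (I * s)) * cexp (-Real.pi * s / 4)
      = I * cexp (-Real.pi * ((1 / s : ℝ) : ℂ) / 4) := by
    conv_rhs => rw [← Complex.exp_pi_div_two_mul_I, ← Complex.exp_add]
    rw [← Complex.exp_add]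
    congr 1
    push_cast
    field_simp
    linear_combination (-4 * (s : ℂ) ^ 2) * I_sq
  have h := jacobiTheta₂'_functional_equation (-1 / 2 + I * s / 2) (I * s)
  rw [neg_I_mul_I_mul_cpow hs, neg_one_div_I_mul hs, hz, jacobiTheta₂_add_left,
    jacobiTheta₂'_add_left, jacobiTheta₂_th1_zero (1 / s), mul_zero, sub_zero] at h
  have e1 := th1D_eq hs
  have e2 := th1D_eq (one_div_pos.2 hs)
  rw [h] at e1
  have : (th1D (1 / s) : ℂ) = s * ((√s : ℝ) : ℂ) * th1D s := by
    have hI := I_ne_zero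
    have hr : ∀ a b c : ℂ, (s : ℂ) * ((√s : ℝ) : ℂ) *
        (-I * a * (1 / ((√s : ℝ) : ℂ) * b / (I * s) * c)) = -(b * a) * c := by
      intro a b c
      field_simp
    rw [e1, e2, hr, he]
    ring
  exact_mod_cast this

/-- After the modular transformation the argument is purely imaginary, so every term of the series
is a positive exponential. -/
lemma th3_pos (hs : 0 < s) (v : ℝ) : 0 < th3 s v := by
  have hs' : 0 < 1 / s := one_div_pos.2 hs
  have h1 : (s : ℂ) ≠ 0 := by exact_mod_cast hs.ne'
  have h := jacobiTheta₂_modular hs v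
  have hsum : HasSum (fun n : ℤ => ((Real.exp (2 * Real.pi * n * v / s - Real.pi * n ^ 2 / s) : ℝ)
      : ℂ)) (jacobiTheta₂ (v / (I * s)) (I * ((1 / s : ℝ) : ℂ))) := by
    refine (hasSum_jacobiTheta₂_term _ (im_I_mul_pos hs')).congr_fun fun n => ?_
    rw [jacobiTheta₂_term]
    push_cast
    congr 1
    field_simp
    linear_combination (-(n : ℂ)^2) * I_sq
  have hr : Summable fun n : ℤ => Real.exp (2 * Real.pi * n * v / s - Real.pi * n ^ 2 / s) :=
    Complex.summable_ofReal.1 hsum.summable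
  have hpos : 0 < ∑' n : ℤ, Real.exp (2 * Real.pi * n * v / s - Real.pi * n ^ 2 / s) :=
    hr.tsum_pos (fun _ => (Real.exp_pos _).le) 0 (Real.exp_pos _)
  rw [← hsum.tsum_eq, ← Complex.ofReal_tsum] at h
  have he : cexp (-Real.pi * I * (v : ℂ) ^ 2 / (I * s))
      = ((Real.exp (-Real.pi * v ^ 2 / s) : ℝ) : ℂ) := by
    push_cast; congr 1; field_simp
  rw [he] at h
  have : th3 s v = 1 / √s * Real.exp (-Real.pi * v ^ 2 / s) *
      ∑' n : ℤ, Real.exp (2 * Real.pi * n * v / s - Real.pi * n ^ 2 / s) := by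
    have h' := ofReal_th3 (s := s) v
    rw [cth3, h] at h'
    exact_mod_cast h'
  rw [this]
  have := Real.sqrt_pos.2 hs
  positivity

lemma th4_pos (hs : 0 < s) (v : ℝ) : 0 < th4 s v := th3_pos hs _

lemma th2_zero_pos (hs : 0 < s) : 0 < th2 s 0 := by
  have h := th4_zero_modular hs
  have := th4_pos (one_div_pos.2 hs) 0
  rw [h] at this
  exact pos_of_mul_pos_right this (Real.sqrt_nonneg _)

end Modular

/-! ### A finite triple product -/

section TripleProduct

/-- `(Q; Q)_n`. -/
def qPoch (Q : ℝ) (n : ℕ) : ℝ := ∏ i ∈ Finset.range n, (1 - Q ^ (i + 1))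

lemma qPoch_succ (Q : ℝ) (n : ℕ) : qPoch Q (n + 1) = qPoch Q n * (1 - Q ^ (n + 1)) :=
  Finset.prod_range_succ _ _

variable {q : ℝ}

lemma one_sub_pow_succ_pos (h0 : 0 < q) (h1 : q < 1) (n : ℕ) : 0 < 1 - q ^ (n + 1) :=
  sub_pos.2 (pow_lt_one₀ h0.le h1 n.succ_ne_zero)

lemma qPoch_pos (h0 : 0 < q) (h1 : q < 1) (n : ℕ) : 0 < qPoch q n :=
  Finset.prod_pos fun i _ => one_sub_pow_succ_pos h0 h1 i

lemma qPoch_le_one (h0 : 0 < q) (h1 : q < 1) (n : ℕ) : qPoch q n ≤ 1 :=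
  Finset.prod_le_one (fun i _ => (one_sub_pow_succ_pos h0 h1 i).le) fun i _ => by
    have : 0 < q ^ (i + 1) := by positivity
    linarith

lemma qPoch_antitone (h0 : 0 < q) (h1 : q < 1) : Antitone (qPoch q) :=
  antitone_nat_of_succ_le fun n => by
    rw [qPoch_succ]
    refine mul_le_of_le_one_right (qPoch_pos h0 h1 n).le ?_
    have : 0 < q ^ (n + 1) := by positivity
    linarith

lemma exists_tendsto_qPoch (h0 : 0 < q) (h1 : q < 1) :
    ∃ c, 0 < c ∧ Filter.Tendsto (qPoch q) Filter.atTop (nhds c) ∧ ∀ n, c ≤ qPoch q n := by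
  have hs : Summable fun i : ℕ => -q ^ (i + 1) :=
    ((summable_nat_add_iff 1).2 (summable_geometric_of_lt_one h0.le h1)).neg
  have ht := (Real.multipliable_one_add_of_summable hs).hasProd.tendsto_prod_nat
  simp only [← sub_eq_add_neg] at ht
  refine ⟨_, ?_, ht, fun n => (qPoch_antitone h0 h1).le_of_tendsto ht n⟩
  refine lt_of_le_of_ne (ge_of_tendsto' ht fun n => (qPoch_pos h0 h1 n).le) (Ne.symm ?_)
  have := tprod_one_add_ne_zero_of_summable (f := fun i : ℕ => -q ^ (i + 1))
    (fun i => by rw [← sub_eq_add_neg]; exact (one_sub_pow_succ_pos h0 h1 i).ne') hs.norm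
  simpa only [← sub_eq_add_neg] using this

/-- The `q`-binomial coefficient of `2 N + 1` and `N - m`. -/
def centralCoeff (Q : ℝ) (N m : ℕ) : ℝ :=
  if m ≤ N then qPoch Q (2 * N + 1) / (qPoch Q (N - m) * qPoch Q (N + 1 + m)) else 0

lemma centralCoeff_of_le {N m : ℕ} (Q : ℝ) (h : m ≤ N) : centralCoeff Q N m =
    qPoch Q (2 * N + 1) / (qPoch Q (N - m) * qPoch Q (N + 1 + m)) := if_pos h

lemma centralCoeff_of_lt {N m : ℕ} (Q : ℝ) (h : N < m) : centralCoeff Q N m = 0 :=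
  if_neg (not_le.2 h)

/-- The effect on the cosine coefficients of multiplying by `1 + 2 Q^(N+1) cos 2z + Q^(2N+2)`, once
the weights `q^(m(m+1))` with `Q = q²` are divided out. The case split is on which neighbouring
coefficients lie beyond `N` and vanish. -/
lemma centralCoeff_succ_succ (h0 : 0 < q) (h1 : q < 1) {N m : ℕ} (hm : m ≤ N) :
    centralCoeff q (N + 1) (m + 1) = (1 + q ^ (2 * N + 2)) * centralCoeff q N (m + 1) +
      q ^ (N - m) * centralCoeff q N m + q ^ (N + 3 + m) * centralCoeff q N (m + 2) := by
  have hp := fun n => (qPoch_pos h0 h1 n).ne'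
  have hq := fun n => (one_sub_pow_succ_pos h0 h1 n).ne'
  have hN : qPoch q (2 * (N + 1) + 1)
      = qPoch q (2 * N + 1) * (1 - q ^ (2 * N + 2)) * (1 - q ^ (2 * N + 3)) := by
    rw [← qPoch_succ, ← qPoch_succ]; rfl
  have a2 : qPoch q (N + 1 + (m + 1)) = qPoch q (N + 1 + m) * (1 - q ^ (N + m + 2)) := by
    rw [show N + 1 + (m + 1) = N + 1 + m + 1 by ring, qPoch_succ]; ring_nf
  have a3 : qPoch q (N + 1 + (m + 2))
      = qPoch q (N + 1 + m) * (1 - q ^ (N + m + 2)) * (1 - q ^ (N + m + 3)) := by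
    rw [show N + 1 + (m + 2) = N + 1 + (m + 1) + 1 by ring, qPoch_succ, a2]; ring_nf
  have a4 : qPoch q (N + 1 + 1 + (m + 1)) = qPoch q (N + 1 + (m + 2)) := by
    congr 1; ring
  have b2 := hq (N + m + 1)
  have b3 := hq (N + m + 2)
  rw [show N + m + 1 + 1 = N + m + 2 by ring] at b2
  rw [show N + m + 2 + 1 = N + m + 3 by ring] at b3
  have c1 := hp (N + 1 + m)
  rw [centralCoeff_of_le q (by omega : m + 1 ≤ N + 1), centralCoeff_of_le q hm,
    show N + 1 - (m + 1) = N - m by omega, hN, a4]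
  rcases Nat.lt_or_ge m N with h | h
  · rcases Nat.lt_or_ge (m + 1) N with h' | h'
    · obtain ⟨d, rfl⟩ : ∃ d, N = m + 2 + d := ⟨N - m - 2, by omega⟩
      rw [centralCoeff_of_le q h'.le, centralCoeff_of_le q (by omega : m + 2 ≤ m + 2 + d), a2, a3,
        show m + 2 + d - m = d + 1 + 1 by omega, show m + 2 + d - (m + 1) = d + 1 by omega,
        show m + 2 + d - (m + 2) = d by omega, qPoch_succ q (d + 1), qPoch_succ q d]
      have d1 := hq d
      have d2 := hq (d + 1)
      have d0 := hp d
      field_simp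
      ring
    · obtain rfl : N = m + 1 := by omega
      rw [centralCoeff_of_le q le_rfl, centralCoeff_of_lt q (by omega : m + 1 < m + 2), a2, a3,
        show m + 1 - m = 0 + 1 by omega, Nat.sub_self, qPoch_succ q 0]
      have d1 := hq 0
      have d0 := hp 0
      field_simp
      ring
  · obtain rfl : N = m := by omega
    rw [centralCoeff_of_lt q (by omega : N < N + 1), centralCoeff_of_lt q (by omega : N < N + 2),
      a3, Nat.sub_self]
    have d0 := hp 0
    field_simp
    ring

/-- At the lowest frequency the neighbour `-1` is `0` itself, the cosine being even; hence the
second term. -/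
lemma centralCoeff_succ_zero (h0 : 0 < q) (h1 : q < 1) (N : ℕ) :
    centralCoeff q (N + 1) 0 = (1 + q ^ (2 * N + 2)) * centralCoeff q N 0 +
      q ^ (N + 1) * centralCoeff q N 0 + q ^ (N + 2) * centralCoeff q N 1 := by
  have hp := fun n => (qPoch_pos h0 h1 n).ne'
  have hq := fun n => (one_sub_pow_succ_pos h0 h1 n).ne'
  have hN : qPoch q (2 * (N + 1) + 1)
      = qPoch q (2 * N + 1) * (1 - q ^ (2 * N + 2)) * (1 - q ^ (2 * N + 3)) := by
    rw [← qPoch_succ, ← qPoch_succ]; rfl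
  rw [centralCoeff_of_le q (Nat.zero_le _), centralCoeff_of_le q (Nat.zero_le _), hN,
    Nat.sub_zero, Nat.sub_zero, add_zero, add_zero]
  rcases N with _ | N
  · rw [centralCoeff_of_lt q Nat.zero_lt_one]
    simp only [qPoch, Finset.prod_range_succ, Finset.prod_range_zero]
    have := hq 0
    have := hq 1
    simp only [zero_add, one_mul, pow_one, mul_zero, add_zero] at *
    field_simp
    ring
  · rw [centralCoeff_of_le q (by omega), show N + 1 - 1 = N by omega, qPoch_succ q N,
      qPoch_succ q (N + 1 + 1), qPoch_succ q (N + 1), qPoch_succ q N]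
    have d1 := hq N
    have d2 := hq (N + 1)
    have d3 := hq (N + 1 + 1)
    have d0 := hp N
    field_simp
    ring

/-- Finite form of the Jacobi triple product for `ϑ₂`. -/
lemma finite_triple_product (h0 : 0 < q) (h1 : q < 1) (z : ℝ) (N : ℕ) :
    2 * Real.cos z * ∏ n ∈ Finset.range N,
        (1 + 2 * (q ^ 2) ^ (n + 1) * Real.cos (2 * z) + ((q ^ 2) ^ (n + 1)) ^ 2) =
      ∑ m ∈ Finset.range (N + 1), q ^ (m * (m + 1)) * centralCoeff (q ^ 2) N m *
        (2 * Real.cos ((2 * m + 1) * z)) := by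
  have hQ0 : 0 < q ^ 2 := by positivity
  have hQ1 : q ^ 2 < 1 := pow_lt_one₀ h0.le h1 two_ne_zero
  induction N with
  | zero =>
    have := (one_sub_pow_succ_pos hQ0 hQ1 0).ne'
    rw [zero_add, pow_one] at this
    simp [centralCoeff, qPoch, div_self this]
  | succ N ih =>
    set C := fun m : ℕ => Real.cos ((2 * m + 1) * z) with hC
    set b := fun m : ℕ => q ^ (m * (m + 1)) * centralCoeff (q ^ 2) N m with hb
    have hC0 : 2 * Real.cos (2 * z) * C 0 = C 0 + C 1 := by
      simp only [hC]; push_cast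
      have e1 : Real.cos ((2 * 1 + 1) * z) = Real.cos (2 * z + z) := by ring_nf
      have e0 : Real.cos ((2 * 0 + 1) * z) = Real.cos (2 * z - z) := by ring_nf
      rw [e1, e0, Real.cos_add, show Real.cos (2 * z - z) = Real.cos z by ring_nf]
      have h := Real.cos_sub (2 * z) z
      rw [show 2 * z - z = z by ring] at h
      linear_combination -h
    have hCs : ∀ m, 2 * Real.cos (2 * z) * C (m + 1) = C m + C (m + 2) := by
      intro m
      simp only [hC]; push_cast
      rw [show (2 * ((m : ℝ) + 2) + 1) * z = (2 * (m + 1) + 1) * z + 2 * z by ring,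
        show (2 * (m : ℝ) + 1) * z = (2 * (m + 1) + 1) * z - 2 * z by ring,
        Real.cos_add, Real.cos_sub]
      ring
    have hbN1 : b (N + 1) = 0 := by
      simp only [hb]; rw [centralCoeff_of_lt _ (Nat.lt_succ_self N), mul_zero]
    have hbN2 : b (N + 2) = 0 := by
      simp only [hb]; rw [centralCoeff_of_lt _ (by omega), mul_zero]
    have hrec0 : q ^ (0 * (0 + 1)) * centralCoeff (q ^ 2) (N + 1) 0 =
        (1 + ((q ^ 2) ^ (N + 1)) ^ 2) * b 0 + (q ^ 2) ^ (N + 1) * (b 0 + b 1) := by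
      simp only [hb]
      rw [centralCoeff_succ_zero hQ0 hQ1]
      ring
    have hrec : ∀ m ∈ Finset.range (N + 1),
        q ^ ((m + 1) * (m + 1 + 1)) * centralCoeff (q ^ 2) (N + 1) (m + 1) * (2 * C (m + 1)) =
        ((1 + ((q ^ 2) ^ (N + 1)) ^ 2) * b (m + 1) + (q ^ 2) ^ (N + 1) * (b m + b (m + 2))) *
          (2 * C (m + 1)) := by
      intro m hm
      have hm' : m ≤ N := Nat.lt_succ_iff.1 (Finset.mem_range.1 hm)
      obtain ⟨d, rfl⟩ := Nat.exists_eq_add_of_le hm'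
      simp only [hb]
      rw [centralCoeff_succ_succ hQ0 hQ1 hm', Nat.add_sub_cancel_left]
      ring
    have ih' : 2 * Real.cos z * ∏ n ∈ Finset.range N,
        (1 + 2 * (q ^ 2) ^ (n + 1) * Real.cos (2 * z) + ((q ^ 2) ^ (n + 1)) ^ 2) =
        ∑ m ∈ Finset.range (N + 1), b m * (2 * C m) := ih
    have hgoal : ∑ m ∈ Finset.range (N + 1 + 1), q ^ (m * (m + 1)) *
          centralCoeff (q ^ 2) (N + 1) m * (2 * Real.cos ((2 * m + 1) * z)) =
        ∑ m ∈ Finset.range (N + 1), q ^ ((m + 1) * (m + 1 + 1)) *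
          centralCoeff (q ^ 2) (N + 1) (m + 1) * (2 * C (m + 1)) +
        q ^ (0 * (0 + 1)) * centralCoeff (q ^ 2) (N + 1) 0 * (2 * C 0) :=
      Finset.sum_range_succ' _ _
    rw [Finset.prod_range_succ, ← mul_assoc, ih', hgoal, Finset.sum_congr rfl hrec, hrec0]
    -- The sums are aligned by index shifts; `b (N + 1) = b (N + 2) = 0` absorbs the upper boundary
    -- terms.
    have s1 : ∑ m ∈ Finset.range (N + 1), b m * (2 * C m) =
        ∑ m ∈ Finset.range (N + 1), b (m + 1) * (2 * C (m + 1)) + b 0 * (2 * C 0) := by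
      rw [← Finset.sum_range_succ' (fun m => b m * (2 * C m)), Finset.sum_range_succ _ (N + 1),
        hbN1]
      ring
    have s2 : ∑ m ∈ Finset.range (N + 1), b (m + 1) * C m =
        ∑ m ∈ Finset.range (N + 1), b (m + 2) * C (m + 1) + b 1 * C 0 := by
      rw [← Finset.sum_range_succ' (fun m => b (m + 1) * C m), Finset.sum_range_succ _ (N + 1),
        hbN2]
      ring
    have s3 : ∑ m ∈ Finset.range (N + 1), b (m + 1) * C (m + 2) + b 0 * C 1 =
        ∑ m ∈ Finset.range (N + 1), b m * C (m + 1) := by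
      rw [← Finset.sum_range_succ' (fun m => b m * C (m + 1)), Finset.sum_range_succ _ (N + 1),
        hbN1]
      ring
    have s4 : 2 * Real.cos (2 * z) * ∑ m ∈ Finset.range (N + 1), b (m + 1) * C (m + 1) =
        ∑ m ∈ Finset.range (N + 1), b (m + 1) * C m +
          ∑ m ∈ Finset.range (N + 1), b (m + 1) * C (m + 2) := by
      rw [Finset.mul_sum, ← Finset.sum_add_distrib]
      refine Finset.sum_congr rfl fun m _ => ?_
      linear_combination b (m + 1) * hCs m
    have s5 : ∑ m ∈ Finset.range (N + 1),
        ((1 + ((q ^ 2) ^ (N + 1)) ^ 2) * b (m + 1) + (q ^ 2) ^ (N + 1) * (b m + b (m + 2))) *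
          (2 * C (m + 1)) =
        2 * (1 + ((q ^ 2) ^ (N + 1)) ^ 2) * ∑ m ∈ Finset.range (N + 1), b (m + 1) * C (m + 1) +
        2 * (q ^ 2) ^ (N + 1) * (∑ m ∈ Finset.range (N + 1), b m * C (m + 1) +
          ∑ m ∈ Finset.range (N + 1), b (m + 2) * C (m + 1)) := by
      rw [Finset.mul_sum, ← Finset.sum_add_distrib, Finset.mul_sum, ← Finset.sum_add_distrib]
      exact Finset.sum_congr rfl fun m _ => by ring
    have s6 : ∑ m ∈ Finset.range (N + 1), b (m + 1) * (2 * C (m + 1)) =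
        2 * ∑ m ∈ Finset.range (N + 1), b (m + 1) * C (m + 1) := by
      rw [Finset.mul_sum]
      exact Finset.sum_congr rfl fun m _ => by ring
    rw [s1, s5, s6]
    linear_combination 2 * (q ^ 2) ^ (N + 1) * (s4 + s2 + s3 + b 0 * hC0)

end TripleProduct

/-! ### The infinite product for `ϑ₂` -/

section ProductLimit

variable {q : ℝ}

lemma theta2_summand (h0 : 0 < q) (z : ℝ) (m : ℕ) :
    q ^ (((m : ℝ) + 1 / 2) ^ 2) * Real.cos ((2 * (m : ℝ) + 1) * z) =
      q ^ (1 / 4 : ℝ) * (q ^ (m * (m + 1)) * Real.cos ((2 * m + 1) * z)) := by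
  rw [← mul_assoc, ← Real.rpow_natCast q, ← Real.rpow_add h0]
  congr 2
  push_cast
  ring

lemma summable_pow_mul_succ (h0 : 0 < q) (h1 : q < 1) : Summable fun m : ℕ => q ^ (m * (m + 1)) :=
  Summable.of_nonneg_of_le (fun _ => by positivity)
    (fun m => pow_le_pow_of_le_one h0.le h1.le (by nlinarith)) (summable_geometric_of_lt_one h0.le h1)

lemma summable_theta2_summand (h0 : 0 < q) (h1 : q < 1) (z : ℝ) :
    Summable fun m : ℕ => q ^ (m * (m + 1)) * Real.cos ((2 * m + 1) * z) :=
  Summable.of_norm_bounded (summable_pow_mul_succ h0 h1) fun m => by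
    rw [norm_mul, Real.norm_of_nonneg (by positivity : 0 ≤ q ^ (m * (m + 1)))]
    exact mul_le_of_le_one_right (by positivity) (Real.abs_cos_le_one _)

lemma theta2_eq_tsum (h0 : 0 < q) (z : ℝ) : theta2 z q =
    q ^ (1 / 4 : ℝ) * ∑' m : ℕ, q ^ (m * (m + 1)) * (2 * Real.cos ((2 * m + 1) * z)) := by
  unfold theta2
  simp_rw [theta2_summand h0]
  rw [tsum_mul_left, mul_left_comm, ← tsum_mul_left]
  simp_rw [mul_left_comm (2 : ℝ)]

lemma theta2_zero_pos (h0 : 0 < q) (h1 : q < 1) : 0 < theta2 0 q := by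
  rw [theta2_eq_tsum h0]
  refine mul_pos (Real.rpow_pos_of_pos h0 _) ?_
  have hs := (summable_pow_mul_succ h0 h1).mul_right 2
  simp only [mul_zero, Real.cos_zero, mul_one]
  exact hs.tsum_pos (fun _ => by positivity) 0 (by positivity)

/-- Each central coefficient tends to the inverse of the limit of `qPoch (q ^ 2)`, under a bound
uniform in `N` and `m`, so dominated convergence applies. That the constant does not depend on `z`
is the point: it cancels in `ϑ₂(z) / ϑ₂(0)`. -/
lemma tendsto_finite_triple_product (h0 : 0 < q) (h1 : q < 1) :
    ∃ c, 0 < c ∧ ∀ z, Filter.Tendsto (fun N : ℕ => 2 * Real.cos z * ∏ n ∈ Finset.range N,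
        (1 + 2 * (q ^ 2) ^ (n + 1) * Real.cos (2 * z) + ((q ^ 2) ^ (n + 1)) ^ 2))
      Filter.atTop (nhds (c * theta2 z q)) := by
  have hQ0 : 0 < q ^ 2 := by positivity
  have hQ1 : q ^ 2 < 1 := pow_lt_one₀ h0.le h1 two_ne_zero
  obtain ⟨c, hc, hlim, hle⟩ := exists_tendsto_qPoch hQ0 hQ1
  refine ⟨1 / c / q ^ (1 / 4 : ℝ), by positivity, fun z => ?_⟩
  simp_rw [finite_triple_product h0 h1]
  have key : Filter.Tendsto (fun N : ℕ => ∑' m : ℕ, q ^ (m * (m + 1)) *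
      centralCoeff (q ^ 2) N m * (2 * Real.cos ((2 * m + 1) * z))) Filter.atTop
      (nhds (∑' m : ℕ, q ^ (m * (m + 1)) * (1 / c) * (2 * Real.cos ((2 * m + 1) * z)))) := by
    refine tendsto_tsum_of_dominated_convergence
      (((summable_pow_mul_succ h0 h1).mul_right (1 / c ^ 2)).mul_right 2) (fun m => ?_)
      (Filter.Eventually.of_forall fun N m => ?_)
    · refine (Filter.Tendsto.const_mul _ ?_).mul_const _
      have hev : (fun N => qPoch (q ^ 2) (2 * N + 1) /
          (qPoch (q ^ 2) (N - m) * qPoch (q ^ 2) (N + 1 + m))) =ᶠ[Filter.atTop]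
          fun N => centralCoeff (q ^ 2) N m := by
        filter_upwards [Filter.eventually_ge_atTop m] with N hN
        rw [centralCoeff_of_le _ hN]
      refine Filter.Tendsto.congr' hev ?_
      have e : 1 / c = c / (c * c) := by field_simp
      rw [e]
      refine Filter.Tendsto.div ?_ (Filter.Tendsto.mul ?_ ?_) (by positivity)
      · exact hlim.comp (Filter.tendsto_atTop_mono (fun n => by simp only [id]; omega)
          Filter.tendsto_id)
      · exact hlim.comp (Filter.tendsto_sub_atTop_nat m)
      · exact hlim.comp (Filter.tendsto_atTop_mono (fun n => by simp only [id]; omega)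
          Filter.tendsto_id)
    · have hcc : 0 ≤ centralCoeff (q ^ 2) N m ∧ centralCoeff (q ^ 2) N m ≤ 1 / c ^ 2 := by
        have hp := qPoch_pos hQ0 hQ1
        rcases le_or_gt m N with h | h
        · rw [centralCoeff_of_le _ h]
          refine ⟨div_nonneg (hp _).le (mul_nonneg (hp _).le (hp _).le), ?_⟩
          rw [sq c]
          exact div_le_div₀ zero_le_one (qPoch_le_one hQ0 hQ1 _) (mul_pos hc hc)
            (mul_le_mul (hle _) (hle _) hc.le (hp _).le)
        · rw [centralCoeff_of_lt _ h]
          exact ⟨le_rfl, by positivity⟩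
      rw [norm_mul, norm_mul, norm_mul, Real.norm_of_nonneg (by positivity : 0 ≤ q ^ (m * (m + 1))),
        Real.norm_of_nonneg hcc.1, Real.norm_of_nonneg zero_le_two]
      have := Real.abs_cos_le_one ((2 * m + 1) * z)
      rw [← Real.norm_eq_abs] at this
      have h2 := hcc.2
      gcongr
      linarith
  have hfin : ∀ N : ℕ, ∑' m : ℕ, q ^ (m * (m + 1)) *
      centralCoeff (q ^ 2) N m * (2 * Real.cos ((2 * m + 1) * z)) =
      ∑ m ∈ Finset.range (N + 1), q ^ (m * (m + 1)) *
      centralCoeff (q ^ 2) N m * (2 * Real.cos ((2 * m + 1) * z)) := fun N =>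
    tsum_eq_sum fun m hm => by
      rw [centralCoeff_of_lt _ (by simpa using hm), mul_zero, zero_mul]
  simp_rw [hfin] at key
  convert key using 2
  rw [theta2_eq_tsum h0]
  have : (q ^ (1 / 4 : ℝ)) ≠ 0 := (Real.rpow_pos_of_pos h0 _).ne'
  rw [div_mul_eq_mul_div, ← tsum_mul_left, ← tsum_mul_left, ← tsum_div_const]
  refine tsum_congr fun m => ?_
  field_simp

end ProductLimit

/-! ### Logarithm of the product as a `q`-series -/

section LogSeries

lemma HasSum.congr_both {ι : Type*} {f g : ι → ℝ} {a b : ℝ} (h : HasSum f a)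
    (hf : ∀ i, g i = f i) (hab : b = a) : HasSum g b := by
  rw [hab, funext hf]; exact h

lemma norm_one_add_sq (r φ : ℝ) :
    ‖1 + (r : ℂ) * Complex.exp (φ * Complex.I)‖ ^ 2 = 1 + 2 * r * Real.cos φ + r ^ 2 := by
  rw [← Complex.normSq_eq_norm_sq, Complex.exp_mul_I, ← Complex.ofReal_cos, ← Complex.ofReal_sin,
    Complex.normSq_apply]
  simp [-Complex.ofReal_cos, -Complex.ofReal_sin]
  linear_combination r ^ 2 * Real.sin_sq_add_cos_sq φ

lemma quad_pos {r : ℝ} (h0 : 0 ≤ r) (h1 : r < 1) (φ : ℝ) :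
    0 < 1 + 2 * r * Real.cos φ + r ^ 2 := by
  nlinarith [Real.neg_one_le_cos φ, sq_pos_of_pos (sub_pos.2 h1)]

/-- Real part of the Taylor series of `-log (1 - w)` at `w = -r e^{iφ}`, as the quadratic is `|1 -
w|²`. The term `n = 0` is zero because `x / 0 = 0`. -/
lemma hasSum_log_quad {r : ℝ} (h0 : 0 ≤ r) (h1 : r < 1) (φ : ℝ) :
    HasSum (fun n : ℕ => (-r) ^ n * Real.cos (n * φ) / n)
      (-(Real.log (1 + 2 * r * Real.cos φ + r ^ 2) / 2)) := by
  have hz : ‖-((r : ℂ) * Complex.exp (φ * Complex.I))‖ < 1 := by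
    rw [norm_neg, norm_mul, Complex.norm_exp_ofReal_mul_I, Complex.norm_real,
      Real.norm_of_nonneg h0, mul_one]
    exact h1
  have h := Complex.hasSum_re (Complex.hasSum_taylorSeries_neg_log hz)
  rw [Complex.neg_re, Complex.log_re, sub_neg_eq_add] at h
  have e : Real.log ‖1 + (r : ℂ) * Complex.exp (φ * Complex.I)‖ =
      Real.log (1 + 2 * r * Real.cos φ + r ^ 2) / 2 := by
    rw [← norm_one_add_sq, Real.log_pow]; push_cast; ring
  rw [e] at h
  refine h.congr_fun fun n => ?_
  have : (-((r : ℂ) * Complex.exp (φ * Complex.I))) ^ n / (n : ℂ) =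
      (((-r) ^ n / n : ℝ) : ℂ) * Complex.exp ((n * φ : ℝ) * Complex.I) := by
    rw [← neg_mul, mul_pow, ← Complex.exp_nat_mul]
    push_cast
    rw [← mul_assoc]; ring
  rw [this, Complex.re_ofReal_mul, Complex.exp_ofReal_mul_I_re]
  ring

lemma hasSum_log_quad_sub {r : ℝ} (h0 : 0 ≤ r) (h1 : r < 1) (z : ℝ) :
    HasSum (fun n : ℕ => 4 * ((-1) ^ (n + 1) / ((n + 1 : ℕ) : ℝ) * r ^ (n + 1) *
        Real.sin ((n + 1 : ℕ) * z) ^ 2))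
      (Real.log (1 + 2 * r * Real.cos (2 * z) + r ^ 2) - Real.log (1 + 2 * r + r ^ 2)) := by
  have a := hasSum_log_quad h0 h1 (2 * z)
  have b := hasSum_log_quad h0 h1 0
  have c := ((b.sub a).mul_left 2)
  rw [← hasSum_nat_add_iff' 1] at c
  simp only [Finset.range_one, Finset.sum_singleton, Nat.cast_zero, div_zero, sub_zero, mul_zero,
    Real.cos_zero, mul_one] at c
  refine HasSum.congr_both c (fun n => ?_) (by ring)
  · rw [show ((n + 1 : ℕ) : ℝ) * (2 * z) = 2 * ((n + 1 : ℕ) * z) by ring, Real.cos_two_mul,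
      Real.cos_sq', neg_pow r]
    ring

variable {q : ℝ}

lemma summable_double_log (h0 : 0 < q) (h1 : q < 1) (z : ℝ) :
    Summable (fun x : ℕ × ℕ => 4 * ((-1) ^ (x.2 + 1) / ((x.2 + 1 : ℕ) : ℝ) *
      ((q ^ 2) ^ (x.1 + 1)) ^ (x.2 + 1) * Real.sin ((x.2 + 1 : ℕ) * z) ^ 2)) := by
  have hQ0 : 0 < q ^ 2 := by positivity
  have hQ1 : q ^ 2 < 1 := pow_lt_one₀ h0.le h1 two_ne_zero
  have hg := summable_geometric_of_lt_one hQ0.le hQ1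
  have hgg := (hg.mul_of_nonneg hg (fun n => by simp; positivity)
    (fun n => by simp; positivity)).mul_left 4
  refine Summable.of_norm_bounded hgg fun x => ?_
  rw [norm_mul, norm_mul, norm_mul, norm_div, norm_pow, norm_neg, norm_one, one_pow,
    Real.norm_of_nonneg (by positivity : 0 ≤ ((q ^ 2) ^ (x.1 + 1)) ^ (x.2 + 1)),
    Real.norm_of_nonneg (sq_nonneg (Real.sin _)), Real.norm_of_nonneg (by norm_num : (0:ℝ) ≤ 4),
    Real.norm_of_nonneg (Nat.cast_nonneg _)]
  have h1' : 1 / ((x.2 + 1 : ℕ) : ℝ) ≤ 1 := by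
    rw [div_le_one (by positivity)]; push_cast; linarith [(Nat.cast_nonneg x.2 : (0:ℝ) ≤ x.2)]
  have h2' : ((q ^ 2) ^ (x.1 + 1)) ^ (x.2 + 1) ≤ (q ^ 2) ^ x.1 * (q ^ 2) ^ x.2 := by
    rw [← pow_mul, ← pow_add]
    exact pow_le_pow_of_le_one hQ0.le hQ1.le (by nlinarith)
  have h3' := Real.sin_sq_le_one ((x.2 + 1 : ℕ) * z)
  have h4' : 0 ≤ (q ^ 2) ^ x.1 * (q ^ 2) ^ x.2 := by positivity
  calc 4 * (1 / ((x.2 + 1 : ℕ) : ℝ) * ((q ^ 2) ^ (x.1 + 1)) ^ (x.2 + 1) *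
        Real.sin ((x.2 + 1 : ℕ) * z) ^ 2)
      ≤ 4 * (1 * ((q ^ 2) ^ x.1 * (q ^ 2) ^ x.2) * 1) := by gcongr
    _ = _ := by ring

lemma hasSum_geometric_col (h0 : 0 < q) (h1 : q < 1) (z : ℝ) (m : ℕ) :
    HasSum (fun n : ℕ => 4 * ((-1) ^ (m + 1) / ((m + 1 : ℕ) : ℝ) *
      ((q ^ 2) ^ (n + 1)) ^ (m + 1) * Real.sin ((m + 1 : ℕ) * z) ^ 2))
      (4 * ((-1) ^ (m + 1) / ((m + 1 : ℕ) : ℝ) *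
        (q ^ (2 * (m + 1)) / (1 - q ^ (2 * (m + 1)))) * Real.sin ((m + 1 : ℕ) * z) ^ 2)) := by
  have hr0 : 0 ≤ q ^ (2 * (m + 1)) := by positivity
  have hr1 : q ^ (2 * (m + 1)) < 1 := pow_lt_one₀ h0.le h1 (by omega)
  have hg := (hasSum_geometric_of_lt_one hr0 hr1).mul_left (4 * ((-1) ^ (m + 1) /
    ((m + 1 : ℕ) : ℝ) * q ^ (2 * (m + 1)) * Real.sin ((m + 1 : ℕ) * z) ^ 2))
  refine HasSum.congr_both hg (fun n => ?_) (by ring)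
  · have : ((q ^ 2) ^ (n + 1)) ^ (m + 1) = q ^ (2 * (m + 1)) * (q ^ (2 * (m + 1))) ^ n := by ring
    rw [this]; ring

/-- Logarithm of `ϑ₂(z|q) / (ϑ₂(0|q) cos z)`. -/
def logThetaSeries (z q : ℝ) : ℝ :=
  4 * ∑' m : ℕ, (-1) ^ (m + 1) / ((m + 1 : ℕ) : ℝ) *
    (q ^ (2 * (m + 1)) / (1 - q ^ (2 * (m + 1)))) * Real.sin ((m + 1 : ℕ) * z) ^ 2

/-- The double series is absolutely summable. Its rows are the logarithms of the factors, and its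
columns are geometric with sums `q^(2m) / (1 - q^(2m))` up to coefficients. -/
lemma hasSum_log_factors (h0 : 0 < q) (h1 : q < 1) (z : ℝ) :
    HasSum (fun n : ℕ => Real.log (1 + 2 * (q ^ 2) ^ (n + 1) * Real.cos (2 * z) +
      ((q ^ 2) ^ (n + 1)) ^ 2) - Real.log (1 + 2 * (q ^ 2) ^ (n + 1) + ((q ^ 2) ^ (n + 1)) ^ 2))
      (logThetaSeries z q) := by
  have hQ0 : 0 < q ^ 2 := by positivity
  have hQ1 : q ^ 2 < 1 := pow_lt_one₀ h0.le h1 two_ne_zero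
  have hs := summable_double_log h0 h1 z
  have hrow := fun n : ℕ => hasSum_log_quad_sub (by positivity : 0 ≤ (q ^ 2) ^ (n + 1))
    (pow_lt_one₀ hQ0.le hQ1 n.succ_ne_zero) z
  have h := hs.hasSum.prod_fiberwise hrow
  convert h using 1
  rw [logThetaSeries, ← tsum_mul_left, hs.tsum_prod, ← Summable.tsum_comm hs]
  exact tsum_congr fun m => (hasSum_geometric_col h0 h1 z m).tsum_eq.symm

lemma summable_logThetaSeries (h0 : 0 < q) (h1 : q < 1) (z : ℝ) :
    Summable fun m : ℕ => (-1) ^ (m + 1) / ((m + 1 : ℕ) : ℝ) *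
      (q ^ (2 * (m + 1)) / (1 - q ^ (2 * (m + 1)))) * Real.sin ((m + 1 : ℕ) * z) ^ 2 := by
  have h := (summable_double_log h0 h1 z).prod_symm.prod
  refine (summable_mul_left_iff (four_ne_zero (α := ℝ))).1 (h.congr fun m => ?_)
  exact (hasSum_geometric_col h0 h1 z m).tsum_eq

/-- Logarithmic form of the product formula for `ϑ₂`. -/
lemma theta2_eq_exp (h0 : 0 < q) (h1 : q < 1) (z : ℝ) :
    theta2 z q = theta2 0 q * (Real.cos z * Real.exp (logThetaSeries z q)) := by
  have hQ0 : 0 < q ^ 2 := by positivity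
  have hQ1 : q ^ 2 < 1 := pow_lt_one₀ h0.le h1 two_ne_zero
  obtain ⟨c, hc, hlim⟩ := tendsto_finite_triple_product h0 h1
  -- The partial product at `z` is `cos z` times the exponential of the partial log sum times the
  -- partial product at `0`; compare limits.
  have hexp := ((Real.continuous_exp.tendsto _).comp
    (hasSum_log_factors h0 h1 z).tendsto_sum_nat).const_mul (Real.cos z)
  have hprod := (hlim 0).mul hexp
  have := tendsto_nhds_unique (hlim z) (hprod.congr fun N => ?_)
  · rw [mul_assoc] at this
    exact mul_left_cancel₀ hc.ne' this
  · have hq1 : ∀ n : ℕ, (q ^ 2) ^ (n + 1) < 1 := fun n => pow_lt_one₀ hQ0.le hQ1 n.succ_ne_zero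
    have hq0 : ∀ n : ℕ, 0 ≤ (q ^ 2) ^ (n + 1) := fun n => by positivity
    simp only [mul_zero, Real.cos_zero, mul_one, Function.comp_apply]
    rw [Real.exp_sum, mul_mul_mul_comm, mul_assoc 2, ← Finset.prod_mul_distrib, mul_assoc 2]
    congr 2
    refine Finset.prod_congr rfl fun n _ => ?_
    have p1 := quad_pos (hq0 n) (hq1 n) (2 * z)
    have p2 : 0 < 1 + 2 * (q ^ 2) ^ (n + 1) + ((q ^ 2) ^ (n + 1)) ^ 2 := by positivity
    rw [Real.exp_sub, Real.exp_log p1, Real.exp_log p2, mul_div_cancel₀ _ p2.ne']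

lemma theta2_pos (h0 : 0 < q) (h1 : q < 1) {z : ℝ} (hz : 0 < Real.cos z) : 0 < theta2 z q := by
  rw [theta2_eq_exp h0 h1]
  exact mul_pos (theta2_zero_pos h0 h1) (mul_pos hz (Real.exp_pos _))

end LogSeries

/-! ### Matching `theta2` with `th2` -/

section ThetaLink

open Complex in
/-- The function of the statement in terms of Mathlib's theta function. -/
lemma theta2_eq_th2 {s : ℝ} (hs : 0 < s) (v : ℝ) :
    theta2 (Real.pi * v) (Real.exp (-Real.pi * s)) = th2 s v := by
  have h0 : 0 < Real.exp (-Real.pi * s) := Real.exp_pos _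
  have h1 : Real.exp (-Real.pi * s) < 1 := by
    rw [Real.exp_lt_one_iff]
    nlinarith [Real.pi_pos]
  have hS : HasSum (fun n : ℤ => cexp (-Real.pi * s / 4 + Real.pi * I * v) *
      jacobiTheta₂_term n (v + I * s / 2) (I * s)) (cth2 s v) :=
    (hasSum_jacobiTheta₂_term _ (im_I_mul_pos hs)).mul_left _
  have hterm : ∀ n : ℤ, (cexp (-Real.pi * s / 4 + Real.pi * I * v) *
      jacobiTheta₂_term n (v + I * s / 2) (I * s)).re =
      Real.exp (-Real.pi * s * (n + 1 / 2) ^ 2) * Real.cos ((2 * n + 1) * (Real.pi * v)) := by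
    intro n
    have e : cexp (-Real.pi * s / 4 + Real.pi * I * v) *
        jacobiTheta₂_term n (v + I * s / 2) (I * s) =
        ((Real.exp (-Real.pi * s * (n + 1 / 2) ^ 2) : ℝ) : ℂ) *
          cexp (((2 * n + 1) * (Real.pi * v) : ℝ) * I) := by
      rw [jacobiTheta₂_term, ← Complex.exp_add, Complex.ofReal_exp, ← Complex.exp_add]
      congr 1
      push_cast
      linear_combination (Real.pi * s * n + Real.pi * s * n ^ 2 : ℂ) * I_sq
    rw [e, Complex.re_ofReal_mul, Complex.exp_ofReal_mul_I_re]
  have hR := Complex.hasSum_re hS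
  simp only [hterm] at hR
  have hsm := (summable_theta2_summand h0 h1 (Real.pi * v)).mul_left
    (Real.exp (-Real.pi * s) ^ (1 / 4 : ℝ))
  simp only [← theta2_summand h0] at hsm
  have hN := hsm.hasSum
  have hrp : ∀ m : ℕ, Real.exp (-Real.pi * s) ^ (((m : ℝ) + 1 / 2) ^ 2) =
      Real.exp (-Real.pi * s * (m + 1 / 2) ^ 2) := fun m => by rw [← Real.exp_mul]
  simp only [hrp] at hN
  -- The reflection `n ↦ -(n + 1)` preserves `(n + 1/2)²` and negates `2 n + 1`, so the two halves
  -- of the integer sum agree; this is the factor 2 in `theta2`.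
  have hZ := HasSum.of_nat_of_neg_add_one (f := fun n : ℤ =>
      Real.exp (-Real.pi * s * (n + 1 / 2) ^ 2) * Real.cos ((2 * n + 1) * (Real.pi * v)))
    (by simpa only [Int.cast_natCast] using hN) (by
      refine HasSum.congr_both hN (fun m => ?_) rfl
      push_cast
      rw [show (2 * (-((m : ℝ) + 1)) + 1) * (Real.pi * v) = -((2 * m + 1) * (Real.pi * v)) by ring,
        Real.cos_neg]
      congr 2
      ring)
  have := hZ.unique hR
  rw [th2, ← this, theta2]
  simp only [hrp]
  ring

lemma th2_pos {s : ℝ} (hs : 0 < s) {v : ℝ} (h0 : -(1 / 2) < v) (h1 : v < 1 / 2) :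
    0 < th2 s v := by
  rw [← theta2_eq_th2 hs]
  refine theta2_pos (Real.exp_pos _) ?_ (Real.cos_pos_of_mem_Ioo ⟨?_, ?_⟩)
  · rw [Real.exp_lt_one_iff]
    nlinarith [Real.pi_pos]
  · nlinarith [Real.pi_pos]
  · nlinarith [Real.pi_pos]

end ThetaLink

/-! ### Jacobi elliptic functions as theta quotients -/

section EllipticTheta

variable {s : ℝ}

/-- `sn` as a theta quotient. -/
def esn (s v : ℝ) : ℝ := th3 s 0 / th2 s 0 * (th1 s v / th4 s v)

/-- `cn` as a theta quotient. -/
def ecn (s v : ℝ) : ℝ := th4 s 0 / th2 s 0 * (th2 s v / th4 s v)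

/-- `dn` as a theta quotient. -/
def edn (s v : ℝ) : ℝ := th4 s 0 / th3 s 0 * (th3 s v / th4 s v)

/-- The modulus as a theta quotient. -/
def ek (s : ℝ) : ℝ := th2 s 0 ^ 2 / th3 s 0 ^ 2

/-- The complementary modulus as a theta quotient. -/
def ekc (s : ℝ) : ℝ := th4 s 0 ^ 2 / th3 s 0 ^ 2

/-- The ratio between the argument of `sn` and that of the theta quotient, equal to `2 K`. -/
def eScale (s : ℝ) : ℝ := th1D s * th3 s 0 / (th2 s 0 * th4 s 0)

lemma esn_sq_add_ecn_sq (hs : 0 < s) (v : ℝ) : esn s v ^ 2 + ecn s v ^ 2 = 1 := by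
  have h := th2_sq_mul hs v
  have h2 := (th2_zero_pos hs).ne'
  have h4 := (th4_pos hs v).ne'
  unfold esn ecn
  field_simp
  linear_combination h

lemma edn_sq (hs : 0 < s) (v : ℝ) : edn s v ^ 2 = 1 - ek s ^ 2 * esn s v ^ 2 := by
  have h := th3_sq_mul hs v
  have h2 := (th2_zero_pos hs).ne'
  have h3 := (th3_pos hs 0).ne'
  have h4 := (th4_pos hs v).ne'
  unfold esn edn ek
  field_simp
  linear_combination h

lemma ek_sq_add_ekc_sq (hs : 0 < s) : ek s ^ 2 + ekc s ^ 2 = 1 := by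
  have h := th3_zero_pow_four hs
  have h3 := (th3_pos hs 0).ne'
  unfold ek ekc
  field_simp
  linear_combination -h

lemma ek_pos (hs : 0 < s) : 0 < ek s := by
  have := th2_zero_pos hs
  have := th3_pos hs 0
  unfold ek
  positivity

lemma ekc_pos (hs : 0 < s) : 0 < ekc s := by
  have := th4_pos hs 0
  have := th3_pos hs 0
  unfold ekc
  positivity

lemma ek_lt_one (hs : 0 < s) : ek s < 1 := by
  have := ek_sq_add_ekc_sq hs
  nlinarith [ekc_pos hs, ek_pos hs]

lemma edn_pos (hs : 0 < s) (v : ℝ) : 0 < edn s v := by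
  have := th3_pos hs 0
  have := th4_pos hs 0
  have := th3_pos hs v
  have := th4_pos hs v
  unfold edn
  positivity

lemma ecn_pos (hs : 0 < s) {v : ℝ} (h0 : -(1 / 2) < v) (h1 : v < 1 / 2) : 0 < ecn s v := by
  have := th2_zero_pos hs
  have := th4_pos hs 0
  have := th2_pos hs h0 h1
  have := th4_pos hs v
  unfold ecn
  positivity

lemma esn_pos (hs : 0 < s) {v : ℝ} (h0 : 0 < v) (h1 : v < 1) : 0 < esn s v := by
  have := th2_zero_pos hs
  have := th3_pos hs 0
  have : 0 < th1 s v := th2_pos hs (by linarith) (by linarith)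
  have := th4_pos hs v
  unfold esn
  positivity

lemma esn_zero : esn s 0 = 0 := by simp [esn, th1_zero]

lemma esn_half (hs : 0 < s) : esn s (1 / 2) = 1 := by
  have h2 := (th2_zero_pos hs).ne'
  have h3 := (th3_pos hs 0).ne'
  rw [esn, th1_half, th4_half]
  field_simp

lemma hasDerivAt_esn (hs : 0 < s) (v : ℝ) :
    HasDerivAt (esn s) (eScale s * (ecn s v * edn s v)) v := by
  have h4 := (th4_pos hs v).ne'
  have d := (((differentiable_th1 hs v).hasDerivAt).div
    (differentiable_th4 hs v).hasDerivAt h4).const_mul (th3 s 0 / th2 s 0)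
  refine d.congr_deriv ?_
  have hw := th1_th4_wronskian hs v
  have h2 := (th2_zero_pos hs).ne'
  have h3 := (th3_pos hs 0).ne'
  have h40 := (th4_pos hs 0).ne'
  unfold eScale ecn edn
  field_simp
  linear_combination hw

lemma continuous_esn (hs : 0 < s) : Continuous (esn s) :=
  continuous_iff_continuousAt.2 fun v => (hasDerivAt_esn hs v).continuousAt

/-- The amplitude in terms of the theta variable. -/
def eam (s v : ℝ) : ℝ := Real.arcsin (esn s v)

lemma abs_esn_le_one (hs : 0 < s) (v : ℝ) : |esn s v| ≤ 1 := by
  rw [← sq_le_one_iff_abs_le_one]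
  nlinarith [esn_sq_add_ecn_sq hs v, sq_nonneg (ecn s v)]

lemma abs_esn_lt_one (hs : 0 < s) {v : ℝ} (h0 : -(1 / 2) < v) (h1 : v < 1 / 2) :
    |esn s v| < 1 := by
  rw [← sq_lt_one_iff_abs_lt_one]
  nlinarith [esn_sq_add_ecn_sq hs v, sq_pos_of_pos (ecn_pos hs h0 h1)]

lemma sin_eam (hs : 0 < s) (v : ℝ) : Real.sin (eam s v) = esn s v :=
  Real.sin_arcsin (abs_le.1 (abs_esn_le_one hs v)).1 (abs_le.1 (abs_esn_le_one hs v)).2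

lemma cos_eam (hs : 0 < s) {v : ℝ} (h0 : -(1 / 2) < v) (h1 : v < 1 / 2) :
    Real.cos (eam s v) = ecn s v := by
  rw [eam, Real.cos_arcsin, show 1 - esn s v ^ 2 = ecn s v ^ 2 by
    linarith [esn_sq_add_ecn_sq hs v], Real.sqrt_sq (ecn_pos hs h0 h1).le]

lemma sqrt_one_sub_esn (hs : 0 < s) (v : ℝ) : √(1 - ek s ^ 2 * esn s v ^ 2) = edn s v := by
  rw [← edn_sq hs, Real.sqrt_sq (edn_pos hs v).le]

lemma continuous_eam (hs : 0 < s) : Continuous (eam s) :=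
  Real.continuous_arcsin.comp (continuous_esn hs)

/-- On this range `cn > 0`, so `√(1 - sn²) = cn` cancels the `cn` in the derivative of `esn`. -/
lemma hasDerivAt_eam (hs : 0 < s) {v : ℝ} (h0 : -(1 / 2) < v) (h1 : v < 1 / 2) :
    HasDerivAt (eam s) (eScale s * edn s v) v := by
  have hlt := abs_lt.1 (abs_esn_lt_one hs h0 h1)
  have d := (Real.hasDerivAt_arcsin hlt.1.ne' hlt.2.ne).comp v (hasDerivAt_esn hs v)
  refine d.congr_deriv ?_
  have hc := ecn_pos hs h0 h1
  rw [show 1 - esn s v ^ 2 = ecn s v ^ 2 by linarith [esn_sq_add_ecn_sq hs v],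
    Real.sqrt_sq hc.le]
  field_simp

lemma eam_zero : eam s 0 = 0 := by simp [eam, esn_zero]

lemma eam_half (hs : 0 < s) : eam s (1 / 2) = Real.pi / 2 := by
  simp only [eam, esn_half hs, Real.arcsin_one]

/-- Change of variables along the amplitude. -/
lemma integral_eam (hs : 0 < s) {g h : ℝ → ℝ} (hg : Continuous g) (hh : Continuous h)
    (h0 : h 0 = 0) (hd : ∀ v, 0 ≤ v → v < 1 / 2 →
      HasDerivAt h (g (eam s v) * (eScale s * edn s v)) v) {v : ℝ} (hv0 : 0 ≤ v)
    (hv1 : v ≤ 1 / 2) : ∫ x in (0 : ℝ)..eam s v, g x = h v := by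
  have hI : ∀ y, HasDerivAt (fun y => ∫ x in (0 : ℝ)..y, g x) (g y) y := fun y =>
    intervalIntegral.integral_hasDerivAt_right (hg.intervalIntegrable _ _)
      hg.stronglyMeasurable.stronglyMeasurableAtFilter hg.continuousAt
  have hIc : Continuous fun y => ∫ x in (0 : ℝ)..y, g x :=
    continuous_iff_continuousAt.2 fun y => (hI y).continuousAt
  -- Continuity on the closed interval and derivatives on `[0, 1/2)` suffice; this reaches `v =
  -- 1/2`, where `arcsin` is not differentiable.
  have hconst := constant_of_has_deriv_right_zero
    (f := fun w => (∫ x in (0 : ℝ)..eam s w, g x) - h w) (a := 0) (b := 1 / 2)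
    ((hIc.comp (continuous_eam hs)).sub hh).continuousOn (fun w hw => by
      have d := ((hI (eam s w)).comp w (hasDerivAt_eam hs (by linarith [hw.1]) hw.2)).sub
        (hd w hw.1 hw.2)
      rw [sub_self] at d
      exact d.hasDerivWithinAt) v ⟨hv0, hv1⟩
  simp only [eam_zero, intervalIntegral.integral_same, h0, sub_zero] at hconst
  linarith

/-- Along the amplitude the integrand is `1 / dn`, which cancels the `dn` in the derivative of
`eam`. -/
lemma ellF_eam (hs : 0 < s) {v : ℝ} (h0 : 0 ≤ v) (h1 : v ≤ 1 / 2) :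
    ellF (eam s v) (ek s) = eScale s * v := by
  refine integral_eam hs (h := fun v => eScale s * v)
    (ellF_integrand_continuous (ek_pos hs).le (ek_lt_one hs))
    (by fun_prop) (mul_zero _) (fun w _ _ => ?_) h0 h1
  rw [sin_eam hs, sqrt_one_sub_esn hs]
  have := (edn_pos hs w).ne'
  refine ((hasDerivAt_id w).const_mul (eScale s)).congr_deriv ?_
  field_simp

lemma ellK_ek (hs : 0 < s) : ellK (ek s) = eScale s / 2 := by
  rw [ellK, ← eam_half hs, ellF_eam hs (by norm_num) le_rfl]
  ring

lemma ellK_pos {k : ℝ} (h0 : 0 ≤ k) (h1 : k < 1) : 0 < ellK k := by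
  have h := sub_le_ellF_sub h0 h1 (a := 0) (b := Real.pi / 2) (by positivity)
  have hz : ellF 0 k = 0 := by simp [ellF]
  rw [hz] at h
  rw [ellK]
  linarith [Real.pi_pos]

lemma eScale_pos (hs : 0 < s) : 0 < eScale s := by
  have h := ellK_pos (ek_pos hs).le (ek_lt_one hs)
  rw [ellK_ek hs] at h
  linarith

lemma jacobiAm_eScale_mul (hs : 0 < s) {v : ℝ} (h0 : 0 ≤ v) (h1 : v ≤ 1 / 2) :
    jacobiAm (eScale s * v) (ek s) = eam s v := by
  rw [← ellF_eam hs h0 h1, jacobiAm_ellF (ek_pos hs).le (ek_lt_one hs)]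

lemma sn_eScale_mul (hs : 0 < s) {v : ℝ} (h0 : 0 ≤ v) (h1 : v ≤ 1 / 2) :
    sn (eScale s * v) (ek s) = esn s v := by
  rw [sn, jacobiAm_eScale_mul hs h0 h1, sin_eam hs]

lemma cn_eScale_mul (hs : 0 < s) {v : ℝ} (h0 : 0 ≤ v) (h1 : v < 1 / 2) :
    cn (eScale s * v) (ek s) = ecn s v := by
  rw [cn, jacobiAm_eScale_mul hs h0 h1.le, cos_eam hs (by linarith) h1]

lemma dn_eScale_mul (hs : 0 < s) {v : ℝ} (h0 : 0 ≤ v) (h1 : v ≤ 1 / 2) :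
    dn (eScale s * v) (ek s) = edn s v := by
  rw [dn, sn_eScale_mul hs h0 h1, sqrt_one_sub_esn hs]

end EllipticTheta

/-! ### The nome, and surjectivity onto moduli -/

section Inversion

variable {s : ℝ}

lemma ekc_eq_ek_one_div (hs : 0 < s) : ekc s = ek (1 / s) := by
  have := (Real.sqrt_pos.2 hs).ne'
  have := (th3_pos hs 0).ne'
  rw [ekc, ek, th2_zero_modular hs, th3_zero_modular hs]
  field_simp

lemma compMod_ek (hs : 0 < s) : compMod (ek s) = ekc s := by
  rw [compMod, ← ek_sq_add_ekc_sq hs, add_sub_cancel_left, Real.sqrt_sq (ekc_pos hs).le]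

lemma eScale_one_div (hs : 0 < s) : eScale (1 / s) = s * eScale s := by
  have := (Real.sqrt_pos.2 hs).ne'
  have := (th2_zero_pos hs).ne'
  have := (th4_pos hs 0).ne'
  rw [eScale, eScale, th2_zero_modular hs, th3_zero_modular hs, th4_zero_modular hs,
    th1D_modular hs]
  field_simp

/-- The complementary modulus belongs to `1 / s`, and `2 K` is multiplied by `s` under the
inversion, so `K(k') / K(k) = s`. -/
lemma nome_ek (hs : 0 < s) : nome (ek s) = Real.exp (-Real.pi * s) := by
  have := (eScale_pos hs).ne'
  rw [nome, compMod_ek hs, ekc_eq_ek_one_div hs, ellK_ek hs, ellK_ek (one_div_pos.2 hs),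
    eScale_one_div hs]
  congr 1
  field_simp

/-- `n²` and `n` have the same parity. This lets one bound for `jacobiTheta` serve both `ϑ₃(0)` and
`ϑ₄(0)`. -/
lemma jacobiTheta₂_half (τ : ℂ) : jacobiTheta₂ (1 / 2) τ = jacobiTheta (τ + 1) := by
  rw [jacobiTheta_eq_jacobiTheta₂]
  refine tsum_congr fun n => ?_
  rw [jacobiTheta₂_term, jacobiTheta₂_term]
  have hpar : Complex.exp (((n ^ 2 : ℤ) : ℂ) * (Real.pi * Complex.I)) =
      Complex.exp ((n : ℂ) * (Real.pi * Complex.I)) := by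
    rw [Complex.exp_int_mul, Complex.exp_int_mul, Complex.exp_pi_mul_I]
    rcases Int.even_or_odd n with h | h
    · rw [h.neg_one_zpow, (h.pow_of_ne_zero two_ne_zero).neg_one_zpow]
    · rw [h.neg_one_zpow, h.pow.neg_one_zpow]
  rw [show (2 * Real.pi * Complex.I * n * (1 / 2) + Real.pi * Complex.I * n ^ 2 * τ : ℂ) =
      n * (Real.pi * Complex.I) + Real.pi * Complex.I * n ^ 2 * τ by ring, Complex.exp_add, ← hpar,
    ← Complex.exp_add]
  congr 1
  push_cast
  ring

lemma tendsto_jacobiTheta {f : ℝ → ℂ} (hf : ∀ s, (f s).im = s) :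
    Filter.Tendsto (fun s => jacobiTheta (f s)) Filter.atTop (nhds 1) := by
  rw [tendsto_iff_norm_sub_tendsto_zero]
  have he : Filter.Tendsto (fun s : ℝ => Real.exp (-Real.pi * s)) Filter.atTop (nhds 0) := by
    simp_rw [neg_mul]
    exact Real.tendsto_exp_neg_atTop_nhds_zero.comp
      (Filter.tendsto_id.const_mul_atTop Real.pi_pos)
  have hb : Filter.Tendsto (fun s : ℝ => 2 / (1 - Real.exp (-Real.pi * s)) *
      Real.exp (-Real.pi * s)) Filter.atTop (nhds 0) := by
    have := ((tendsto_const_nhds (x := (2 : ℝ))).div (he.const_sub 1) (by norm_num)).mul he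
    simpa using this
  refine squeeze_zero' (Filter.Eventually.of_forall fun _ => norm_nonneg _) ?_ hb
  filter_upwards [Filter.eventually_gt_atTop 0] with s hs
  have := norm_jacobiTheta_sub_one_le (τ := f s) (by rwa [hf])
  rwa [hf] at this

lemma tendsto_ekc : Filter.Tendsto ekc Filter.atTop (nhds 1) := by
  have h3 : Filter.Tendsto (fun s => th3 s 0) Filter.atTop (nhds 1) := by
    have h := tendsto_jacobiTheta (f := fun s : ℝ => Complex.I * s) (by simp)
    simp only [jacobiTheta_eq_jacobiTheta₂, ← th3_zero_eq] at h
    simpa [Function.comp_def] using! (Complex.continuous_re.tendsto _).comp h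
  have h4 : Filter.Tendsto (fun s => th4 s 0) Filter.atTop (nhds 1) := by
    have h := tendsto_jacobiTheta (f := fun s : ℝ => Complex.I * s + 1) (by simp)
    simp only [← jacobiTheta₂_half, ← th4_zero_eq] at h
    simpa [Function.comp_def] using! (Complex.continuous_re.tendsto _).comp h
  have := (h4.pow 2).div (h3.pow 2) (by norm_num)
  simpa [ekc] using! this

lemma continuousOn_ekc : ContinuousOn ekc (Set.Ioi 0) := by
  intro s hs
  have key : ∀ v : ℝ, ContinuousAt (fun s : ℝ => th3 s v) s := by
    intro v
    have h1 := continuousAt_jacobiTheta₂ (v : ℂ) (im_I_mul_pos hs)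
    have h2 : ContinuousAt (fun s : ℝ => ((v : ℂ), Complex.I * (s : ℂ))) s := by fun_prop
    exact Complex.continuous_re.continuousAt.comp (ContinuousAt.comp (f := fun s : ℝ =>
      ((v : ℂ), Complex.I * (s : ℂ))) h1 h2)
  refine ContinuousAt.continuousWithinAt ?_
  exact (((key (0 + 1 / 2)).pow 2).div ((key 0).pow 2) (pow_pos (th3_pos hs 0) 2).ne')

/-- Every modulus in `(0, 1)` is a theta quotient. -/
lemma exists_ek_eq {k : ℝ} (h0 : 0 < k) (h1 : k < 1) : ∃ s, 0 < s ∧ ek s = k := by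
  have hk : 0 < 1 - k ^ 2 := by nlinarith
  set c := √(1 - k ^ 2) with hc
  have hc0 : 0 < c := Real.sqrt_pos.2 hk
  have hc2 : c ^ 2 = 1 - k ^ 2 := Real.sq_sqrt hk.le
  have hc1 : c < 1 := by nlinarith
  -- `ekc a > c` gives one end of the intermediate value argument. `ekc a > k` gives the other: it
  -- forces `ekc (1 / a) = ek a < c`.
  obtain ⟨a, ha0, hac, hak⟩ := ((Filter.eventually_gt_atTop (0 : ℝ)).and
    (((tendsto_ekc.eventually (lt_mem_nhds hc1))).and
      (tendsto_ekc.eventually (lt_mem_nhds h1)))).exists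
  have hb0 : 0 < 1 / a := one_div_pos.2 ha0
  have hbc : ekc (1 / a) < c := by
    rw [ekc_eq_ek_one_div hb0, one_div_one_div]
    have := ek_sq_add_ekc_sq ha0
    nlinarith [ek_pos ha0]
  obtain ⟨s, hs, hsc⟩ := isPreconnected_Ioi.intermediate_value (a := 1 / a) (b := a) hb0 ha0
    continuousOn_ekc ⟨hbc.le, hac.le⟩
  refine ⟨s, hs, ?_⟩
  have h := ek_sq_add_ekc_sq hs
  rw [hsc, hc2] at h
  have hp := ek_pos hs
  nlinarith

end Inversion

/-! ### Integrals of the third kind -/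

section ThirdKind

variable {s : ℝ}

/-- Logarithmic derivative of `ϑ₄`. -/
def zeta4 (s v : ℝ) : ℝ := deriv (th4 s) v / th4 s v

/-- The logarithm of `ϑ₄(u + a) / ϑ₄(u - a)`. -/
def logQuot (s a u : ℝ) : ℝ := Real.log (th4 s (u + a)) - Real.log (th4 s (u - a))

lemma hasDerivAt_log_th4 (hs : 0 < s) (v : ℝ) :
    HasDerivAt (fun v => Real.log (th4 s v)) (zeta4 s v) v :=
  (differentiable_th4 hs v).hasDerivAt.log (th4_pos hs v).ne'

/-- Addition formula for the logarithmic derivative of `ϑ₄`. -/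
lemma zeta4_add_sub (hs : 0 < s) (u a : ℝ) :
    (zeta4 s (u + a) - zeta4 s (u - a)) * (th4 s u ^ 2 * th4 s a ^ 2 - th1 s u ^ 2 * th1 s a ^ 2) =
      2 * th4 s u ^ 2 * th4 s a * deriv (th4 s) a - 2 * th1 s u ^ 2 * th1 s a * deriv (th1 s) a := by
  have d1 := (differentiable_th1 hs a).hasDerivAt
  have d4 := (differentiable_th4 hs a).hasDerivAt
  -- Differentiate `th4_add_mul_th4_sub` in its second variable at `a`, with `u` fixed.
  have hL := ((((differentiable_th4 hs (u + a)).hasDerivAt).comp_const_add u a).mul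
    (((differentiable_th4 hs (u - a)).hasDerivAt).comp_const_sub u a)).mul_const (th4 s 0 ^ 2)
  have hR := ((d4.pow 2).const_mul (th4 s u ^ 2)).sub ((d1.pow 2).const_mul (th1 s u ^ 2))
  have h := hL.unique (hR.congr_of_eventuallyEq
    (Filter.Eventually.of_forall fun y => th4_add_mul_th4_sub hs u y))
  have hadd := th4_add_mul_th4_sub hs u a
  have p := (th4_pos hs (u + a)).ne'
  have m := (th4_pos hs (u - a)).ne'
  rw [← hadd, zeta4, zeta4]
  field_simp
  push_cast at h
  linear_combination h

lemma ek_mul_esn_sq (hs : 0 < s) (v : ℝ) : ek s * esn s v ^ 2 = th1 s v ^ 2 / th4 s v ^ 2 := by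
  have := (th2_zero_pos hs).ne'
  have := (th3_pos hs 0).ne'
  unfold ek esn
  field_simp

lemma charN_bound (hs : 0 < s) (a u : ℝ) : ek s ^ 2 * esn s a ^ 2 * esn s u ^ 2 < 1 := by
  have h1 := (sq_le_one_iff_abs_le_one _).2 (abs_esn_le_one hs a)
  have h2 := (sq_le_one_iff_abs_le_one _).2 (abs_esn_le_one hs u)
  have hk : ek s ^ 2 < 1 := by nlinarith [ek_pos hs, ek_lt_one hs]
  have h3 : esn s a ^ 2 * esn s u ^ 2 ≤ 1 := mul_le_one₀ h1 (sq_nonneg _) h2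
  nlinarith [sq_nonneg (ek s), mul_nonneg (sq_nonneg (esn s a)) (sq_nonneg (esn s u))]

/-- As a function of `u`, the derivative is a constant minus a multiple of `1 / (1 - n sn² u)`, `n =
k² sn² a`. This comes from `zeta4_add_sub`, with the derivative of `th1` at `a` eliminated by the
Wronskian. -/
lemma hasDerivAt_logQuot (hs : 0 < s) {a : ℝ} (ha0 : 0 < a) (ha1 : a < 1) (u : ℝ) :
    HasDerivAt (logQuot s a) (2 * zeta4 s a + 2 * eScale s * ecn s a * edn s a / esn s a -
      2 * eScale s * ecn s a * edn s a / esn s a /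
        (1 - ek s ^ 2 * esn s a ^ 2 * esn s u ^ 2)) u := by
  have d := ((hasDerivAt_log_th4 hs (u + a)).comp_add_const u a).sub
    ((hasDerivAt_log_th4 hs (u - a)).comp_sub_const u a)
  refine d.congr_deriv ?_
  have hz := zeta4_add_sub hs u a
  have hb := sub_pos.2 (charN_bound hs a u)
  have e : ek s ^ 2 * esn s a ^ 2 * esn s u ^ 2 =
      th1 s a ^ 2 / th4 s a ^ 2 * (th1 s u ^ 2 / th4 s u ^ 2) := by
    rw [← ek_mul_esn_sq hs, ← ek_mul_esn_sq hs]; ring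
  have p4a := (th4_pos hs a).ne'
  have p4u := (th4_pos hs u).ne'
  have p1a : th1 s a ≠ 0 := (th2_pos hs (by linarith) (by linarith)).ne'
  have hw := th1_th4_wronskian hs a
  have h2 := (th2_zero_pos hs).ne'
  have h3 := (th3_pos hs 0).ne'
  have h40 := (th4_pos hs 0).ne'
  have hfrac : 2 * eScale s * ecn s a * edn s a / esn s a =
      2 * (deriv (th1 s) a * th4 s a - th1 s a * deriv (th4 s) a) / (th1 s a * th4 s a) := by
    unfold eScale ecn edn esn
    field_simp
    linear_combination -hw
  rw [hfrac]
  rw [e] at hb ⊢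
  have hb' : th4 s u ^ 2 * th4 s a ^ 2 - th1 s u ^ 2 * th1 s a ^ 2 ≠ 0 := by
    intro h0
    apply hb.ne'
    field_simp
    linear_combination h0
  have hzz := eq_div_of_mul_eq hb' hz
  have hden : 1 - th1 s a ^ 2 / th4 s a ^ 2 * (th1 s u ^ 2 / th4 s u ^ 2) =
      (th4 s u ^ 2 * th4 s a ^ 2 - th1 s u ^ 2 * th1 s a ^ 2) / (th4 s u ^ 2 * th4 s a ^ 2) := by
    field_simp
  rw [hzz, hden, zeta4]
  field_simp
  ring

lemma logQuot_zero (a : ℝ) : logQuot s a 0 = 0 := by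
  rw [logQuot, zero_add, zero_sub, th4_neg, sub_self]

lemma logQuot_half (a : ℝ) : logQuot s a (1 / 2) = 0 := by
  rw [logQuot, add_comm, th4_add_half, show 1 / 2 - a = -(a - 1 / 2) by ring, th4_neg,
    th4_sub_half, sub_self]

/-- The incomplete integral of the third kind in terms of theta functions. -/
lemma ellPi_eam (hs : 0 < s) {a : ℝ} (ha0 : 0 < a) (ha1 : a < 1 / 2) {v : ℝ} (hv0 : 0 ≤ v)
    (hv1 : v ≤ 1 / 2) : ellPi (eam s v) (ek s ^ 2 * esn s a ^ 2) (ek s) =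
      esn s a / (2 * ecn s a * edn s a) * ((2 * zeta4 s a +
        2 * eScale s * ecn s a * edn s a / esn s a) * v - logQuot s a v) := by
  have hc := (ecn_pos hs (by linarith) ha1).ne'
  have hd := (edn_pos hs a).ne'
  have hn := (esn_pos hs ha0 (by linarith)).ne'
  have hderiv := hasDerivAt_logQuot hs ha0 (by linarith : a < 1)
  refine integral_eam hs (h := fun v => esn s a / (2 * ecn s a * edn s a) * ((2 * zeta4 s a +
        2 * eScale s * ecn s a * edn s a / esn s a) * v - logQuot s a v)) ?_ ?_ ?_ ?_ hv0 hv1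
  · have hk1 := ek_lt_one hs
    have hk0 := ek_pos hs
    have hk : ek s ^ 2 < 1 := by nlinarith
    have hsn := (sq_le_one_iff_abs_le_one _).2 (abs_esn_le_one hs a)
    refine continuous_const.div (by fun_prop) fun x => ?_
    have hx := Real.sin_sq_le_one x
    have h1 : 0 < 1 - ek s ^ 2 * Real.sin x ^ 2 := by nlinarith [sq_nonneg (ek s)]
    have h2 : 0 < 1 - ek s ^ 2 * esn s a ^ 2 * Real.sin x ^ 2 := by
      have : esn s a ^ 2 * Real.sin x ^ 2 ≤ 1 := mul_le_one₀ hsn (sq_nonneg _) hx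
      nlinarith [sq_nonneg (ek s)]
    exact mul_ne_zero h2.ne' (Real.sqrt_pos.2 h1).ne'
  · have : Continuous (logQuot s a) :=
      continuous_iff_continuousAt.2 fun u => (hderiv u).continuousAt
    fun_prop
  · rw [logQuot_zero]; ring
  · intro w _ _
    refine ((((hasDerivAt_id w).const_mul _).sub (hderiv w)).const_mul _).congr_deriv ?_
    rw [sin_eam hs, sqrt_one_sub_esn hs]
    have hw := (edn_pos hs w).ne'
    have hb := (sub_pos.2 (charN_bound hs a w)).ne'
    field_simp
    ring

end ThirdKind

/-! ### The half-argument identity for the prefactor -/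

section HalfArgument

variable {s : ℝ}

/-- With `2 a - 1/2 = x`, apply the mixed addition formula at `(a, a - 1/2)`, `(a, 1/2 - a)` and
`(a, a)`. The first two add up to make the numerator of `1 + sn x` a multiple of `(ϑ₁(a) ϑ₄(a))²`;
the third factors `cn x`. -/
lemma half_argument_formula (hs : 0 < s) {x : ℝ} (h0 : 0 < x) (h1 : x < 1 / 2) :
    ekc s * ecn s x / (1 + esn s x) =
      ecn s (1 / 4 + x / 2) * edn s (1 / 4 + x / 2) / esn s (1 / 4 + x / 2) := by
  set a := 1 / 4 + x / 2 with ha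
  have m1 := th1_add_mul_th4_sub hs a (a - 1 / 2)
  have m2 := th1_add_mul_th4_sub hs a (-(a - 1 / 2))
  have m3 := th1_add_mul_th4_sub hs a a
  rw [show a + (a - 1 / 2) = x by rw [ha]; ring, show a - (a - 1 / 2) = 1 / 2 by ring, th4_half,
    th1_sub_half, th4_sub_half] at m1
  rw [show a + -(a - 1 / 2) = 1 / 2 by ring, show a - -(a - 1 / 2) = x by rw [ha]; ring, th1_half,
    th1_neg, th2_neg, th3_neg, th4_neg, th1_sub_half, th4_sub_half] at m2
  rw [show a + a = x + 1 / 2 by rw [ha]; ring, sub_self, th1_add_half] at m3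
  have e2 : th2 s (a - 1 / 2) = th1 s a := rfl
  rw [e2, th3_sub_half] at m1 m2
  have p2 := (th2_zero_pos hs).ne'
  have p3 := (th3_pos hs 0).ne'
  have p4 := (th4_pos hs 0).ne'
  have pa1 : th1 s a ≠ 0 := (th2_pos hs (by linarith) (by linarith)).ne'
  have pa4 := (th4_pos hs a).ne'
  have px4 := (th4_pos hs x).ne'
  have hpos : 1 + esn s x ≠ 0 := by
    have := esn_pos hs h0 (by linarith : x < 1)
    positivity
  have hsum : (th2 s 0 * th4 s x + th3 s 0 * th1 s x) * (th2 s 0 * th3 s 0) =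
      2 * (th1 s a * th4 s a) ^ 2 := by
    linear_combination m1 + m2
  have hne : th2 s 0 * th4 s x + th3 s 0 * th1 s x ≠ 0 := by
    intro h
    rw [h, zero_mul] at hsum
    exact pow_ne_zero 2 (mul_ne_zero pa1 pa4) (by linarith)
  have e1 : 1 + esn s x = (th2 s 0 * th4 s x + th3 s 0 * th1 s x) / (th2 s 0 * th4 s x) := by
    unfold esn
    field_simp
  rw [e1]
  unfold ekc ecn edn esn
  field_simp
  have hs1 : th2 s x * th4 s 0 * (th2 s 0 * th3 s 0) =
      2 * (th1 s a * th4 s a) * (th2 s a * th3 s a) := by linear_combination m3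
  have hq : th1 s a * th4 s a ≠ 0 := mul_ne_zero pa1 pa4
  have hr : th2 s 0 * th3 s 0 ≠ 0 := mul_ne_zero p2 p3
  have key : th2 s x * th4 s 0 * (th1 s a * th4 s a) =
      (th2 s 0 * th4 s x + th3 s 0 * th1 s x) * (th2 s a * th3 s a) := by
    apply mul_right_cancel₀ hr
    linear_combination (th1 s a * th4 s a) * hs1 - th2 s a * th3 s a * hsum
  linear_combination key

end HalfArgument

/-! ### Evaluation of the endpoint equation -/

section Endpoint

variable {s : ℝ}

/-- Reflection in the quarter period; it places `ν_0` at `v = 1/2 - a`. -/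
lemma esn_half_sub (hs : 0 < s) (a : ℝ) : esn s (1 / 2 - a) = ecn s a / edn s a := by
  have := (th2_zero_pos hs).ne'
  have := (th3_pos hs 0).ne'
  have := (th4_pos hs 0).ne'
  have := (th3_pos hs a).ne'
  have := (th4_pos hs a).ne'
  have e1 : th1 s (1 / 2 - a) = th2 s a := by
    rw [show 1 / 2 - a = -a + 1 / 2 by ring, th1_add_half, th2_neg]
  have e4 : th4 s (1 / 2 - a) = th3 s a := by
    rw [show 1 / 2 - a = -a + 1 / 2 by ring, th4_add_half, th3_neg]
  rw [esn, ecn, edn, e1, e4]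
  field_simp

/-- The bracket of complete and incomplete integrals of the third kind. -/
lemma ellPi_bracket (hs : 0 < s) {x : ℝ} (h0 : 0 < x) (h1 : x < 1 / 2) :
    ellPi (eam s (1 / 4 + x / 2)) (ek s ^ 2 * esn s (1 / 4 + x / 2) ^ 2) (ek s)
      - ellPi (eam s (1 / 2 - (1 / 4 + x / 2))) (ek s ^ 2 * esn s (1 / 4 + x / 2) ^ 2) (ek s)
      - 2 * x * ellPi (Real.pi / 2) (ek s ^ 2 * esn s (1 / 4 + x / 2) ^ 2) (ek s) =
    -(esn s (1 / 4 + x / 2) / (2 * ecn s (1 / 4 + x / 2) * edn s (1 / 4 + x / 2))) *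
      (Real.log (th3 s x) + Real.log (th4 s x) - Real.log (th3 s 0) - Real.log (th4 s 0)) := by
  have ha0 : 0 < 1 / 4 + x / 2 := by linarith
  have ha1 : 1 / 4 + x / 2 < 1 / 2 := by linarith
  rw [← eam_half hs, ellPi_eam hs ha0 ha1 ha0.le ha1.le,
    ellPi_eam hs ha0 ha1 (by linarith) (by linarith),
    ellPi_eam hs ha0 ha1 (by norm_num) le_rfl, logQuot_half]
  have e1 : logQuot s (1 / 4 + x / 2) (1 / 4 + x / 2) =
      Real.log (th3 s x) - Real.log (th4 s 0) := by
    rw [logQuot, sub_self, show 1 / 4 + x / 2 + (1 / 4 + x / 2) = x + 1 / 2 by ring, th4_add_half]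
  have e2 : logQuot s (1 / 4 + x / 2) (1 / 2 - (1 / 4 + x / 2)) =
      Real.log (th3 s 0) - Real.log (th4 s x) := by
    rw [logQuot, sub_add_cancel, show 1 / 2 - (1 / 4 + x / 2) - (1 / 4 + x / 2) = -x by ring,
      th4_half, th4_neg]
  -- The linear parts cancel because `a - (1/2 - a) - 2 x (1/2) = 0`.
  rw [e1, e2]
  ring

lemma endpoint_rhs (hs : 0 < s) {p : ℝ} (hp : 2 < p) :
    p / 4 * Real.log (dn (argX p (ek s)) (ek s) / cn (argX p (ek s)) (ek s) ^ 2) +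
      p / 2 * (compMod (ek s) * cn (argX p (ek s)) (ek s) / (1 + sn (argX p (ek s)) (ek s))) *
        (ellPi (nuInf p (ek s)) (charN p (ek s)) (ek s)
          - ellPi (nuZero p (ek s)) (charN p (ek s)) (ek s)
          - 2 / p * ellPi (Real.pi / 2) (charN p (ek s)) (ek s)) =
    -(p / 2) * Real.log (th2 s (1 / p) / th2 s 0) := by
  have hp0 : 0 < p := by linarith
  obtain ⟨x, hx⟩ : ∃ x, x = 1 / p := ⟨_, rfl⟩
  have hx0 : 0 < x := by rw [hx]; positivity
  have hx1 : x < 1 / 2 := by rw [hx]; exact one_div_lt_one_div_of_lt two_pos hp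
  have ha0 : 0 ≤ 1 / 4 + x / 2 := by linarith
  have ha1 : 1 / 4 + x / 2 < 1 / 2 := by linarith
  have hX : argX p (ek s) = eScale s * x := by
    rw [argX, ellK_ek hs, hx]; ring
  have hXh : argXhat p (ek s) / 2 = eScale s * (1 / 4 + x / 2) := by
    rw [argXhat, ellK_ek hs, hx]; field_simp; ring
  have hinf : nuInf p (ek s) = eam s (1 / 4 + x / 2) := by
    rw [nuInf, hXh, sn_eScale_mul hs ha0 ha1.le, eam]
  have hzero : nuZero p (ek s) = eam s (1 / 2 - (1 / 4 + x / 2)) := by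
    rw [nuZero, hXh, cn_eScale_mul hs ha0 ha1, dn_eScale_mul hs ha0 ha1.le, ← esn_half_sub hs, eam]
  have hchar : charN p (ek s) = ek s ^ 2 * esn s (1 / 4 + x / 2) ^ 2 := by
    rw [charN, hXh, sn_eScale_mul hs ha0 ha1.le]
  rw [hinf, hzero, hchar, hX, sn_eScale_mul hs hx0.le hx1.le, cn_eScale_mul hs hx0.le hx1,
    dn_eScale_mul hs hx0.le hx1.le, compMod_ek hs, half_argument_formula hs hx0 hx1,
    show 2 / p = 2 * x by rw [hx]; ring, ellPi_bracket hs hx0 hx1, ← hx]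
  have hc := (ecn_pos hs (by linarith) ha1).ne'
  have hd := (edn_pos hs (1 / 4 + x / 2)).ne'
  have hn := (esn_pos hs (by linarith : 0 < 1 / 4 + x / 2) (by linarith)).ne'
  have q20 := (th2_zero_pos hs).ne'
  have q30 := (th3_pos hs 0).ne'
  have q40 := (th4_pos hs 0).ne'
  have q2 := (th2_pos hs (by linarith) hx1).ne'
  have q3 := (th3_pos hs x).ne'
  have q4 := (th4_pos hs x).ne'
  have hlog : Real.log (edn s x / ecn s x ^ 2) = 2 * Real.log (th2 s 0) + Real.log (th3 s x) +
      Real.log (th4 s x) - (Real.log (th3 s 0) + Real.log (th4 s 0) + 2 * Real.log (th2 s x)) := by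
    have : edn s x / ecn s x ^ 2 =
        th2 s 0 ^ 2 * th3 s x * th4 s x / (th3 s 0 * th4 s 0 * th2 s x ^ 2) := by
      unfold edn ecn
      field_simp
    rw [this, Real.log_div (by positivity) (by positivity), Real.log_mul (by positivity) q4,
      Real.log_mul (by positivity) q3, Real.log_mul (by positivity) (by positivity),
      Real.log_mul q30 q40, Real.log_pow, Real.log_pow]
    push_cast
    ring
  rw [hlog, Real.log_div q2 q20]
  -- The point `a` now occurs only in `sn a`, `cn a`, `dn a`, which cancel between prefactor and
  -- bracket.
  generalize 1 / 4 + x / 2 = a at hc hd hn ⊢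
  field_simp
  ring

end Endpoint

/-! ### The `q`-series and the critical coupling -/

section SeriesForm

lemma qTerm_succ (p q : ℝ) (n : ℕ) : qTerm p q (n + 1) =
    (-1) ^ (n + 1) / ((n + 1 : ℕ) : ℝ) * (q ^ (2 * (n + 1)) / (1 - q ^ (2 * (n + 1)))) *
      Real.sin ((n + 1 : ℕ) * (Real.pi / p)) ^ 2 := by
  rw [qTerm, show Real.pi * ((n + 1 : ℕ) : ℝ) / p = (n + 1 : ℕ) * (Real.pi / p) by ring]

lemma cos_pi_div_pos {p : ℝ} (hp : 2 < p) : 0 < Real.cos (Real.pi / p) := by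
  have hpi := Real.pi_pos
  refine Real.cos_pos_of_mem_Ioo ⟨?_, div_lt_div_of_pos_left hpi two_pos hp⟩
  have : 0 < Real.pi / p := by positivity
  linarith

lemma log_theta2_ratio {p q : ℝ} (hp : 2 < p) (h0 : 0 < q) (h1 : q < 1) :
    tCrit p / 4 - 2 * p * ∑' n : ℕ, qTerm p q (n + 1) =
      -(p / 2) * Real.log (theta2 (Real.pi / p) q / theta2 0 q) := by
  have hc := cos_pi_div_pos hp
  have ht := (theta2_zero_pos h0 h1).ne'
  rw [theta2_eq_exp h0 h1 (Real.pi / p), mul_div_cancel_left₀ _ ht,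
    Real.log_mul hc.ne' (Real.exp_pos _).ne', Real.log_exp, logThetaSeries, tCrit, Real.log_pow,
    one_div, Real.log_inv]
  simp only [qTerm_succ]
  push_cast
  ring

end SeriesForm

end

end TwoCut

theorem mainTheorem5 (p k : ℝ) (hp : 2 < p) (hk0 : 0 < k) (hk1 : k < 1) :
    (0 < TwoCut.nome k ∧ TwoCut.nome k < 1) ∧
    Summable (fun n : ℕ => TwoCut.qTerm p (TwoCut.nome k) (n + 1)) ∧
    0 < TwoCut.theta2 (Real.pi / p) (TwoCut.nome k) ∧
    0 < TwoCut.theta2 0 (TwoCut.nome k) ∧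
    ∀ t : ℝ,
      (TwoCut.EndpointEq t p k ↔
        t / 4 = TwoCut.tCrit p / 4
          - 2 * p * ∑' n : ℕ, TwoCut.qTerm p (TwoCut.nome k) (n + 1)) ∧
      (TwoCut.EndpointEq t p k ↔
        t / 4 = -(p / 2) *
          Real.log (TwoCut.theta2 (Real.pi / p) (TwoCut.nome k) /
            TwoCut.theta2 0 (TwoCut.nome k))) := by

  -- From here on the modulus is a theta quotient.
  obtain ⟨s, hs, rfl⟩ := TwoCut.exists_ek_eq hk0 hk1
  have hq := TwoCut.nome_ek hs
  have h0 : 0 < TwoCut.nome (TwoCut.ek s) := Real.exp_pos _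
  have h1 : TwoCut.nome (TwoCut.ek s) < 1 := by
    rw [hq, Real.exp_lt_one_iff]
    nlinarith [Real.pi_pos]
  have hsum := TwoCut.summable_logThetaSeries h0 h1 (Real.pi / p)
  have hth : ∀ v, TwoCut.theta2 (Real.pi * v) (TwoCut.nome (TwoCut.ek s)) = TwoCut.th2 s v := by
    intro v
    rw [hq, TwoCut.theta2_eq_th2 hs]
  have hrhs : ∀ t, TwoCut.EndpointEq t p (TwoCut.ek s) ↔ t / 4 = -(p / 2) *
      Real.log (TwoCut.theta2 (Real.pi / p) (TwoCut.nome (TwoCut.ek s)) /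
        TwoCut.theta2 0 (TwoCut.nome (TwoCut.ek s))) := by
    intro t
    have e0 := hth 0
    have e1 := hth (1 / p)
    rw [mul_zero] at e0
    rw [mul_one_div] at e1
    rw [TwoCut.EndpointEq, TwoCut.endpoint_rhs hs hp, e0, e1]
  refine ⟨⟨h0, h1⟩, hsum.congr fun n => (TwoCut.qTerm_succ p _ n).symm,
    TwoCut.theta2_pos h0 h1 (TwoCut.cos_pi_div_pos hp), TwoCut.theta2_zero_pos h0 h1,
    fun t => ⟨?_, hrhs t⟩⟩
  rw [TwoCut.log_theta2_ratio hp h0 h1]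
  exact hrhs t
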